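/- Let $K$ be a field and let $A=K[x_1,\dots,x_n]/Q$ be a standard graded $K$-algebra, i.e. $\deg x_i=1$ and $Q$ is a proper homogeneous ideal. Let $I\subset A$ be an ideal generated by homogeneous elements that all have the same degree $d$. The Rees ring $R(I)=A[It]=\bigoplus_{j\ge 0}I^jt^j$ is bigraded by $R(I)_{(i,j)}=(I^j)_{i+dj}\,t^j$, so that the residue classes of the $x_i$ have degree $(1,0)$ and $ft$ has degree $(0,1)$ for every $f\in I$ that is homogeneous of degree $d$; we regard $R(I)$ as a standard graded $K$-algebra through the total degree, $R(I)_k=\bigoplus_{i+j=k}R(I)_{(i,j)}$. For a standard graded $K$-algebra $B$, a finitely generated graded $B$-module $M$ is said to have an $a$-linear resolution if it has a graded free resolution of the form $\cdots\to B(-a-2)^{b_2}\to B(-a-1)^{b_1}\to B(-a)^{b_0}\to M\to 0$ with all $b_i$ finite (in particular, the zero module has an $a$-linear resolution for every $a$). The algebra $B$ is called Koszul if its residue class field $K$, concentrated in degree $0$, has a $0$-linear resolution over $B$. If $R(I)$ is Koszul, then $A$ is Koszul and, for every $j\ge 0$, the ideal $I^j$ with the grading inherited from $A$ has a $dj$-linear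 resolution over $A$. -/

import Mathlib

/-- A standard graded algebra over a field `K`: a nonzero commutative `K`-algebra
`A = ⨁ 𝒜 k` with `𝒜 0 = K · 1`, generated as a `K`-algebra by the finite-dimensional space `𝒜 1`.
Equivalently, `A ≅ K[x₁, …, xₙ] / Q` with `deg xᵢ = 1` and `Q` a proper homogeneous ideal. -/
structure IsStandardGraded {K A : Type*} [Field K] [CommRing A] [Algebra K A]
    (𝒜 : ℕ → Submodule K A) [GradedAlgebra 𝒜] : Prop where
  nontrivial : Nontrivial A
  degree_zero : 𝒜 0 = 1
  adjoin_degree_one : Algebra.adjoin K (𝒜 1 : Set A) = ⊤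
  fg_degree_one : (𝒜 1).FG

/-- An `a`-linear free resolution over the graded `K`-algebra `A = ⨁ 𝒜 k` of the graded module
`M = ⨁ ℳ k`: an exact complex `⋯ ⟶ F₂ ⟶ F₁ ⟶ F₀ ⟶ M ⟶ 0` of degree-preserving maps with
`F i = A(-a-i) ^ (rank i)`. Since the basis vectors of `F i` all have degree `a + i`, a map
`F (i+1) ⟶ F i` preserves degrees iff the entries of its matrix lie in `𝒜 1`, and a map `F 0 ⟶ M`
preserves degrees iff it sends the basis vectors to `ℳ a`.
(The resolution is automatically minimal.) -/
structure LinearResolution {K A M : Type*} [Field K] [CommRing A] [Algebra K A]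
    [AddCommGroup M] [Module K M] [Module A M]
    (𝒜 : ℕ → Submodule K A) (ℳ : ℕ → Submodule K M) (a : ℕ) where
  /-- The rank of the `i`-th free module. -/
  rank : ℕ → ℕ
  /-- The differentials. -/
  d : ∀ i : ℕ, (Fin (rank (i + 1)) → A) →ₗ[A] (Fin (rank i) → A)
  /-- The augmentation. -/
  ε : (Fin (rank 0) → A) →ₗ[A] M
  d_mem : ∀ (i : ℕ) (k : Fin (rank (i + 1))) (l : Fin (rank i)), d i (Pi.single k 1) l ∈ 𝒜 1
  ε_mem : ∀ k : Fin (rank 0), ε (Pi.single k 1) ∈ ℳ a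
  exact_d : ∀ i : ℕ, Function.Exact (d (i + 1)) (d i)
  exact_ε : Function.Exact (d 0) ε
  surjective_ε : Function.Surjective ε

/-- The graded module `M` has an `a`-linear resolution over the graded algebra `A`. -/
def HasLinearResolution {K A M : Type*} [Field K] [CommRing A] [Algebra K A]
    [AddCommGroup M] [Module K M] [Module A M]
    (𝒜 : ℕ → Submodule K A) (ℳ : ℕ → Submodule K M) (a : ℕ) : Prop :=
  Nonempty (LinearResolution 𝒜 ℳ a)

/-- The graded maximal ideal of a standard graded algebra, generated by the homogeneous elements
of positive degree. -/
def gradedMaximalIdeal {K A : Type*} [Field K] [CommRing A] [Algebra K A]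
    (𝒜 : ℕ → Submodule K A) : Ideal A :=
  Ideal.span {x | ∃ k, 0 < k ∧ x ∈ 𝒜 k}

/-- The grading of the residue class module `A / 𝔪` of a graded algebra `A` with graded maximal
ideal `𝔪`: the `k`-th component is the image of `𝒜 k`. For a standard graded algebra this is the
residue class field `K`, concentrated in degree `0`. -/
def residueGrading {K A : Type*} [Field K] [CommRing A] [Algebra K A]
    (𝒜 : ℕ → Submodule K A) (k : ℕ) : Submodule K (A ⧸ gradedMaximalIdeal 𝒜) :=
  (𝒜 k).map (Ideal.Quotient.mkₐ K (gradedMaximalIdeal 𝒜)).toLinearMap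

/-- A standard graded algebra is Koszul if its residue class field, placed in degree `0`, has a
linear free resolution. -/
def IsKoszul {K A : Type*} [Field K] [CommRing A] [Algebra K A]
    (𝒜 : ℕ → Submodule K A) : Prop :=
  HasLinearResolution 𝒜 (residueGrading 𝒜) 0

/-- The grading that an ideal `J` inherits from `A` : the `k`-th component is `J ∩ 𝒜 k`. -/
def idealGrading {K A : Type*} [Field K] [CommRing A] [Algebra K A]
    (𝒜 : ℕ → Submodule K A) (J : Ideal A) (k : ℕ) : Submodule K J :=
  (𝒜 k).comap (J.subtype.restrictScalars K)

/-- The ideal `I` is generated by homogeneous elements of degree `d`. -/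
def IsGeneratedInDegree {K A : Type*} [Field K] [CommRing A] [Algebra K A]
    (𝒜 : ℕ → Submodule K A) (I : Ideal A) (d : ℕ) : Prop :=
  ∃ s : Set A, s ⊆ 𝒜 d ∧ I = Ideal.span s

/-- The bigrading of the Rees ring `R(I) = A[It] = ⨁ Iʲ tʲ` of an ideal `I` generated in degree `d`:
the `(i, j)`-th component consists of the `c tʲ` with `c ∈ Iʲ` homogeneous of degree `i + d j`. So
the elements of `𝒜 1` have degree `(1, 0)` and `f t` has degree `(0, 1)` for `f ∈ I ∩ 𝒜 d`. -/
noncomputable def reesBigrading {K A : Type*} [Field K] [CommRing A] [Algebra K A]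
    (𝒜 : ℕ → Submodule K A) (I : Ideal A) (d : ℕ) (p : ℕ × ℕ) : Submodule K (reesAlgebra I) :=
  ((𝒜 (p.1 + d * p.2)).map ((Polynomial.monomial p.2).restrictScalars K)).comap
    ((reesAlgebra I).val.toLinearMap.restrictScalars K)

/-- The total grading of the Rees ring: `R(I)ₖ = ⨁_{i + j = k} R(I)_(i, j)`. -/
noncomputable def reesGrading {K A : Type*} [Field K] [CommRing A] [Algebra K A]
    (𝒜 : ℕ → Submodule K A) (I : Ideal A) (d : ℕ) (k : ℕ) : Submodule K (reesAlgebra I) :=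
  ⨆ p ∈ Finset.HasAntidiagonal.antidiagonal k, reesBigrading 𝒜 I d p

/-! Write R for the Rees ring, F for the linear resolution of K over R with matrices `D`, 𝔪 for the
graded maximal ideal of A, and π : R → A, t ↦ 0, for the retraction of A → R. The matrices E =
π(`D`) are used as a test complex over A: `ExactIn` on consecutive graded pieces of a module M says,
in place of vanishing Tor, that F ⊗ M has no homology off the linear strand.

E is exact on A in positive degrees (`exists_boundary_of_retract`). Multiplication by elements of 𝔪
is null-homotopic on F, and the homotopies extend to a system of higher ones, that is, a chain map Q
⊗ F → F with Q a free A-resolution of A/𝔪. Applying π gives a left inverse of E → Q ⊗ E. So H(E)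
embeds in H(Q ⊗ E) = H(E/𝔪E), and there a cycle with coordinates in 𝔪 becomes zero.

Passing the test suffices for linearity. Exactness in homological degree 0 forces generation in the
lowest degree, and the long exact sequence transfers the test to the kernel of a free cover.
Iterating yields a linear resolution (`IsLinearSyzygy.hasLinearResolution`); applied to 𝔪 this shows
that A is Koszul.

It remains to test Iʲ, which up to a shift is the strand of R of y-degree j, where y-degree is the
power of t (`exactIn_yDeg`). As R and A pass the test, so does ker π, over R. Its iterated syzygies
have free covers whose generators have positive y-degree. In y-degree j > 0 the strand of ker π is
that of R, and it is thereby resolved by strands of R of y-degree less than j, so induction on j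
applies. -/

/-! ### Linear complexes with coefficients in a module -/

section Boundary

variable {B B' M M' : Type*} [CommRing B] [CommRing B'] [AddCommGroup M] [Module B M]
  [AddCommGroup M'] [Module B' M'] {f : ℕ → ℕ}

/-- The `i`-th differential of the complex of free modules with matrices `D`, with coefficients
in the module `M`. -/
def bd (D : ∀ i, Fin (f (i + 1)) → Fin (f i) → B) (i : ℕ) :
    (Fin (f (i + 1)) → M) →ₗ[B] (Fin (f i) → M) where
  toFun w l := ∑ k, D i k l • w k
  map_add' v w := by ext l; simp [smul_add, Finset.sum_add_distrib]
  map_smul' r w := by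
    ext l
    simp only [Pi.smul_apply, RingHom.id_apply, Finset.smul_sum]
    exact Finset.sum_congr rfl fun k _ => smul_comm _ _ _

theorem bd_apply (D : ∀ i, Fin (f (i + 1)) → Fin (f i) → B) (i : ℕ) (w : Fin (f (i + 1)) → M)
    (l : Fin (f i)) : bd D i w l = ∑ k, D i k l • w k := rfl

/-- Cycles of the complex with coefficients in `M`. -/
def IsCyc (D : ∀ i, Fin (f (i + 1)) → Fin (f i) → B) : ∀ i, (Fin (f i) → M) → Prop
  | 0, _ => True
  | i + 1, c => bd D i c = 0

/-- The matrices `D` form a complex. -/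
def IsCpx (D : ∀ i, Fin (f (i + 1)) → Fin (f i) → B) : Prop :=
  ∀ i k m, ∑ l, D (i + 1) k l * D i l m = 0

/-- Every `i`-cycle with coordinates in `T` is the boundary of a chain with coordinates in `S`. -/
def ExactIn (D : ∀ i, Fin (f (i + 1)) → Fin (f i) → B) (S T : AddSubgroup M) (i : ℕ) : Prop :=
  ∀ c : Fin (f i) → M, (∀ k, c k ∈ T) → IsCyc D i c →
    ∃ w : Fin (f (i + 1)) → M, (∀ k, w k ∈ S) ∧ bd D i w = c

theorem IsCpx.bd_bd {D : ∀ i, Fin (f (i + 1)) → Fin (f i) → B} (hD : IsCpx D) (i : ℕ)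
    (w : Fin (f (i + 2)) → M) : bd D i (bd D (i + 1) w) = 0 := by
  ext m
  simp only [bd_apply, Finset.smul_sum, smul_smul, Pi.zero_apply]
  rw [Finset.sum_comm]
  refine Finset.sum_eq_zero fun k _ => ?_
  rw [← Finset.sum_smul]
  have := hD i k m
  rw [show ∑ l, D i l m * D (i + 1) k l = ∑ l, D (i + 1) k l * D i l m from
    Finset.sum_congr rfl fun l _ => mul_comm _ _, this, zero_smul]

theorem IsCpx.isCyc_bd {D : ∀ i, Fin (f (i + 1)) → Fin (f i) → B} (hD : IsCpx D) (i : ℕ)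
    (w : Fin (f (i + 1)) → M) : IsCyc D i (bd D i w) := by
  cases i with
  | zero => trivial
  | succ i => exact hD.bd_bd i w

theorem IsCpx.map {D : ∀ i, Fin (f (i + 1)) → Fin (f i) → B} (hD : IsCpx D) (φ : B →+* B') :
    IsCpx fun i k l => φ (D i k l) := by
  intro i k m
  simp only [← map_mul, ← map_sum, hD i k m, map_zero]

theorem bd_map {M'' : Type*} [AddCommGroup M''] [Module B M'']
    (D : ∀ i, Fin (f (i + 1)) → Fin (f i) → B) (q : M →ₗ[B] M'') (i : ℕ)
    (w : Fin (f (i + 1)) → M) :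
    (fun l => q (bd D i w l)) = bd D i (fun k => q (w k)) := by
  ext l
  simp [bd_apply]

theorem IsCyc.map {D : ∀ i, Fin (f (i + 1)) → Fin (f i) → B}
    {D' : ∀ i, Fin (f (i + 1)) → Fin (f i) → B'} {q : M →+ M'}
    (hq : ∀ i (w : Fin (f (i + 1)) → M), (fun l => q (bd D i w l)) = bd D' i (fun k => q (w k)))
    {i : ℕ} {c : Fin (f i) → M} (hc : IsCyc D i c) : IsCyc D' i (fun k => q (c k)) := by
  cases i with
  | zero => trivial
  | succ i =>
    change bd D' i _ = 0
    rw [← hq i c, show bd D i c = 0 from hc]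
    ext l
    simp

/-- The kernel part of the long exact homology sequence. -/
theorem ExactIn.ker {D : ∀ i, Fin (f (i + 1)) → Fin (f i) → B}
    {D' : ∀ i, Fin (f (i + 1)) → Fin (f i) → B'} (hD : IsCpx D) (q : M →+ M')
    (hq : ∀ i (w : Fin (f (i + 1)) → M), (fun l => q (bd D i w l)) = bd D' i (fun k => q (w k)))
    {G₀ G₁ G₂ : AddSubgroup M} {M₀ M₁ : AddSubgroup M'}
    (hG : ∀ i, ExactIn D G₁ G₂ i) (hM : ∀ i, ExactIn D' M₀ M₁ i)
    (h₁ : ∀ x ∈ G₁, q x ∈ M₁) (h₀ : ∀ y ∈ M₀, ∃ x ∈ G₀, q x = y)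
    (hd : ∀ i (w : Fin (f (i + 1)) → M), (∀ k, w k ∈ G₀) → ∀ l, bd D i w l ∈ G₁) (i : ℕ) :
    ExactIn D (G₁ ⊓ q.ker) (G₂ ⊓ q.ker) i := by
  intro c hc hcyc
  obtain ⟨w, hw, hwc⟩ := hG i c (fun k => (hc k).1) hcyc
  have hz : IsCyc D' (i + 1) (fun k => q (w k)) := by
    change bd D' i _ = 0
    rw [← hq i w, hwc]
    ext l
    exact (hc l).2
  obtain ⟨u', hu', hu'w⟩ := hM (i + 1) _ (fun k => h₁ _ (hw k)) hz
  choose u hu huq using fun k => h₀ _ (hu' k)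
  refine ⟨w - bd D (i + 1) u, fun k => ⟨G₁.sub_mem (hw k) (hd _ u hu k), ?_⟩, ?_⟩
  · have h1 := congrFun (hq (i + 1) u) k
    have h2 := congrFun hu'w k
    change q ((w - bd D (i + 1) u) k) = 0
    rw [Pi.sub_apply, map_sub, h1, funext huq, h2, sub_self]
  · rw [map_sub, hD.bd_bd, sub_zero, hwc]

/-- The cokernel part of the long exact homology sequence. -/
theorem ExactIn.of_surjective {D : ∀ i, Fin (f (i + 1)) → Fin (f i) → B}
    {D' : ∀ i, Fin (f (i + 1)) → Fin (f i) → B'} (hD : IsCpx D) (q : M →+ M')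
    (hq : ∀ i (w : Fin (f (i + 1)) → M), (fun l => q (bd D i w l)) = bd D' i (fun k => q (w k)))
    {G₀ G₁ G₂ : AddSubgroup M} {M₀ M₁ : AddSubgroup M'} {i : ℕ}
    (hG : ExactIn D G₀ G₁ i) (hN : ∀ i', i = i' + 1 → ExactIn D (G₁ ⊓ q.ker) (G₂ ⊓ q.ker) i')
    (h₀ : ∀ x ∈ G₀, q x ∈ M₀) (h₁ : ∀ y ∈ M₁, ∃ x ∈ G₁, q x = y)
    (hd : ∀ i (w : Fin (f (i + 1)) → M), (∀ k, w k ∈ G₁) → ∀ l, bd D i w l ∈ G₂) :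
    ExactIn D' M₀ M₁ i := by
  intro c' hc' hcyc'
  choose c hc hcq using fun k => h₁ _ (hc' k)
  have key : ∃ u : Fin (f i) → M, (∀ k, u k ∈ G₁ ⊓ q.ker) ∧ IsCyc D i (c - u) := by
    cases i with
    | zero => exact ⟨0, fun k => (G₁ ⊓ q.ker).zero_mem, trivial⟩
    | succ i' =>
      obtain ⟨u, hu, huc⟩ := hN i' rfl (bd D i' c) (fun l => ⟨hd _ c hc l, by
        have h1 := congrFun (hq i' c) l
        change q (bd D i' c l) = 0
        rw [h1, funext hcq, show bd D' i' c' = 0 from hcyc']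
        rfl⟩) (hD.isCyc_bd _ _)
      refine ⟨u, hu, ?_⟩
      change bd D i' (c - u) = 0
      rw [map_sub, huc, sub_self]
  obtain ⟨u, hu, hcu⟩ := key
  obtain ⟨w, hw, hwc⟩ := hG (c - u) (fun k => G₁.sub_mem (hc k) (hu k).1) hcu
  refine ⟨fun k => q (w k), fun k => h₀ _ (hw k), ?_⟩
  rw [← hq i w, hwc]
  ext l
  rw [Pi.sub_apply, map_sub, hcq, show q (u l) = 0 from (hu l).2, sub_zero]

end Boundary

/-! ### Higher homotopies -/

section Homotopy

variable {A R : Type*} [CommRing A] [CommRing R] [Algebra A R] {f y : ℕ → ℕ}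

/-- The total differential on the product of the terms of a complex of free modules. -/
def tot (D : ∀ i, Fin (f (i + 1)) → Fin (f i) → R) :
    (∀ n, Fin (f n) → R) →ₗ[R] (∀ n, Fin (f n) → R) :=
  LinearMap.pi fun n => bd D n ∘ₗ LinearMap.proj (n + 1)

theorem tot_apply (D : ∀ i, Fin (f (i + 1)) → Fin (f i) → R) (x : ∀ n, Fin (f n) → R) (n : ℕ) :
    tot D x n = bd D n (x (n + 1)) := rfl

/-- A merely set-theoretic section is enough: it is evaluated only to define homotopies on basis
elements, which are then extended linearly. -/
theorem exists_tot_section {D : ∀ i, Fin (f (i + 1)) → Fin (f i) → R} (𝔞 : Ideal R)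
    (hex : ∀ n (x : Fin (f (n + 1)) → R), bd D n x = 0 → ∃ z, bd D (n + 1) z = x)
    (hex₀ : ∀ x : Fin (f 0) → R, (∀ k, x k ∈ 𝔞) → ∃ z, bd D 0 z = x) :
    ∃ h : (∀ n, Fin (f n) → R) → (∀ n, Fin (f n) → R), ∀ x, tot D x = 0 → (∀ k, x 0 k ∈ 𝔞) →
      tot D (h x) = x ∧ h x 0 = 0 := by
  have H : ∀ x : ∀ n, Fin (f n) → R, ∃ z : ∀ n, Fin (f n) → R, tot D x = 0 →
      (∀ k, x 0 k ∈ 𝔞) → tot D z = x ∧ z 0 = 0 := by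
    intro x
    by_cases hx : tot D x = 0 ∧ ∀ k, x 0 k ∈ 𝔞
    · have H' : ∀ n, ∃ z, bd D n z = x n := by
        rintro (_ | n)
        · exact hex₀ _ hx.2
        · exact hex n _ (congrFun hx.1 n)
      choose z hz using H'
      -- The preimage of the component `x n` sits in homological degree n + 1, which leaves degree 0
      -- free to be zero.
      refine ⟨fun n => Nat.casesOn n 0 z, fun _ _ => ⟨?_, rfl⟩⟩
      ext1 n
      exact hz n
    · exact ⟨0, fun h1 h2 => (hx ⟨h1, h2⟩).elim⟩
  choose h hh using H
  exact ⟨h, hh⟩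

/-- The action of the differential on the source of a family of vectors indexed by the basis
elements of a complex. -/
def famBd (D : ∀ i, Fin (f (i + 1)) → Fin (f i) → R) {V : Type*} [AddCommGroup V] [Module R V]
    (s : ∀ p, Fin (f p) → V) : ∀ p, Fin (f p) → V
  | 0 => 0
  | p + 1 => fun l => ∑ m, D p l m • s p m

/-- The homotopy recursively determined by a section `h` of the differential and the family `g`
that is to be made null-homotopic. -/
def liftFam (D : ∀ i, Fin (f (i + 1)) → Fin (f i) → R)
    (h : (∀ n, Fin (f n) → R) → (∀ n, Fin (f n) → R)) (u : R)
    (g : ∀ p, Fin (f p) → ∀ n, Fin (f n) → R) : ∀ p, Fin (f p) → ∀ n, Fin (f n) → R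
  | 0 => fun l => h (g 0 l)
  | p + 1 => fun l => h (u • ∑ m, D p l m • liftFam D h u g p m + g (p + 1) l)

/-- The hypothesis `hg` makes the right-hand side of each equation a cycle once the previous
equation holds, so the section solves it. Since the solution vanishes in degree 0, the next
right-hand side has the degree-0 component of `g` alone, which lies in 𝔞. -/
theorem liftFam_spec {D : ∀ i, Fin (f (i + 1)) → Fin (f i) → R} (hD : IsCpx D) {𝔞 : Ideal R}
    {h : (∀ n, Fin (f n) → R) → (∀ n, Fin (f n) → R)}
    (hh : ∀ x, tot D x = 0 → (∀ k, x 0 k ∈ 𝔞) → tot D (h x) = x ∧ h x 0 = 0)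
    {u : R} {g : ∀ p, Fin (f p) → ∀ n, Fin (f n) → R}
    (hg : ∀ p l, tot D (g p l) = -(u • famBd D g p l)) (hg₀ : ∀ p l k, g p l 0 k ∈ 𝔞) (p : ℕ) :
    ∀ l, tot D (liftFam D h u g p l) = u • famBd D (liftFam D h u g) p l + g p l ∧
      liftFam D h u g p l 0 = 0 := by
  induction p with
  | zero =>
    intro l
    have := hh (g 0 l) (by rw [hg]; simp [famBd]) (hg₀ 0 l)
    simpa [famBd, liftFam] using this
  | succ p ih =>
    intro l
    refine hh _ ?_ fun k => ?_
    · have h1 : ∀ m, tot D (liftFam D h u g p m) =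
        u • famBd D (liftFam D h u g) p m + g p m := fun m => (ih m).1
      have h2 : ∑ m, D p l m • famBd D (liftFam D h u g) p m = 0 := by
        cases p with
        | zero => simp [famBd]
        | succ p =>
          simp only [famBd, Finset.smul_sum, smul_smul]
          rw [Finset.sum_comm]
          refine Finset.sum_eq_zero fun k _ => ?_
          rw [← Finset.sum_smul, hD p l k, zero_smul]
      simp only [map_add, map_smul, map_sum, h1, hg, smul_add, Finset.sum_add_distrib]
      rw [show ∑ m, D p l m • u • famBd D (liftFam D h u g) p m =
        u • ∑ m, D p l m • famBd D (liftFam D h u g) p m by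
          rw [Finset.smul_sum]; exact Finset.sum_congr rfl fun m _ => smul_comm _ _ _, h2]
      simp [famBd]
    · have : (u • ∑ m, D p l m • liftFam D h u g p m + g (p + 1) l) 0 = g (p + 1) l 0 := by
        rw [Pi.add_apply, Pi.smul_apply, Finset.sum_apply]
        simp [fun m => (ih m).2]
      rw [this]
      exact hg₀ _ _ _

end Homotopy

/-! ### Higher homotopies from a resolution over A -/

section Homotopy

variable {A R : Type*} [CommRing A] [CommRing R] [Algebra A R] {f y : ℕ → ℕ}

/-- A system of higher homotopies for the action on a complex of free `R`-modules of a
resolution over `A` with matrices `Q`. -/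
def homotopySystem (D : ∀ i, Fin (f (i + 1)) → Fin (f i) → R)
    (h : (∀ n, Fin (f n) → R) → (∀ n, Fin (f n) → R))
    (Q : ∀ i, Fin (y (i + 1)) → Fin (y i) → A) :
    ∀ q, Fin (y q) → ∀ p, Fin (f p) → ∀ n, Fin (f n) → R
  | 0 => fun _ p l => Pi.single p (Pi.single l 1)
  | q + 1 => fun k => liftFam D h ((-1) ^ (q + 1))
      fun p l => ∑ k', algebraMap A R (Q q k k') • homotopySystem D h Q q k' p l

theorem famBd_sum (D : ∀ i, Fin (f (i + 1)) → Fin (f i) → R) {V : Type*} [AddCommGroup V]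
    [Module R V] {n : ℕ} (a : Fin n → R) (s : Fin n → ∀ p, Fin (f p) → V) (p : ℕ) (l : Fin (f p)) :
    famBd D (fun p l => ∑ k, a k • s k p l) p l = ∑ k, a k • famBd D (s k) p l := by
  cases p with
  | zero => simp [famBd]
  | succ p =>
    simp only [famBd, Finset.smul_sum]
    rw [Finset.sum_comm]
    exact Finset.sum_congr rfl fun k _ => Finset.sum_congr rfl fun m _ => smul_comm _ _ _

theorem tot_single (D : ∀ i, Fin (f (i + 1)) → Fin (f i) → R) (p : ℕ) (l : Fin (f p)) :
    tot D (Pi.single p (Pi.single l 1)) =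
      famBd D (fun p l => (Pi.single p (Pi.single l 1) : ∀ n, Fin (f n) → R)) p l := by
  cases p with
  | zero =>
    ext1 n
    rw [tot_apply, Pi.single_eq_of_ne (by omega)]
    simp [famBd]
  | succ p =>
    simp only [famBd]
    ext n m
    rw [tot_apply, Finset.sum_apply, Finset.sum_apply]
    rcases eq_or_ne n p with rfl | hn
    · simp [bd_apply, Pi.single_apply]
    · rw [Pi.single_eq_of_ne (by omega)]
      simp [hn]

/-- These identities say that the homotopies form a chain map Q ⊗ F → F. The family to be killed at
level q + 1 is a signed chain map because Q is a complex; the sign alternates with q. -/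
theorem homotopySystem_spec {D : ∀ i, Fin (f (i + 1)) → Fin (f i) → R} (hD : IsCpx D)
    {𝔪 : Ideal A} {h : (∀ n, Fin (f n) → R) → (∀ n, Fin (f n) → R)}
    (hh : ∀ x, tot D x = 0 → (∀ k, x 0 k ∈ 𝔪.map (algebraMap A R)) → tot D (h x) = x ∧ h x 0 = 0)
    {Q : ∀ i, Fin (y (i + 1)) → Fin (y i) → A} (hQ : IsCpx Q) (hQ₀ : ∀ k l, Q 0 k l ∈ 𝔪) (q : ℕ) :
    ∀ k p l, tot D (homotopySystem D h Q (q + 1) k p l) =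
        (-1 : R) ^ (q + 1) • famBd D (homotopySystem D h Q (q + 1) k) p l +
          ∑ k', algebraMap A R (Q q k k') • homotopySystem D h Q q k' p l ∧
      homotopySystem D h Q (q + 1) k p l 0 = 0 := by
  induction q with
  | zero =>
    intro k p l
    refine liftFam_spec hD hh (fun p l => ?_) (fun p l m => ?_) p l
    · rw [map_sum, famBd_sum]
      simp [homotopySystem, tot_single]
    · rw [Finset.sum_apply, Finset.sum_apply]
      exact Ideal.sum_mem _ fun k' _ => Ideal.mul_mem_right _ _ (Ideal.mem_map_of_mem _ (hQ₀ _ _))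
  | succ q ih =>
    intro k p l
    refine liftFam_spec hD hh (fun p l => ?_) (fun p l m => ?_) p l
    · rw [map_sum, famBd_sum]
      simp only [map_smul, fun k' => (ih k' p l).1, smul_add, Finset.sum_add_distrib]
      have h1 : ∑ k', algebraMap A R (Q (q + 1) k k') •
          ∑ k'', algebraMap A R (Q q k' k'') • homotopySystem D h Q q k'' p l = 0 := by
        simp only [Finset.smul_sum, smul_smul, ← map_mul]
        rw [Finset.sum_comm]
        refine Finset.sum_eq_zero fun k'' _ => ?_
        rw [← Finset.sum_smul, ← map_sum, hQ q k k'', map_zero, zero_smul]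
      rw [h1, add_zero, Finset.smul_sum, ← Finset.sum_neg_distrib]
      refine Finset.sum_congr rfl fun k' _ => ?_
      rw [smul_comm, pow_succ (-1 : R) (q + 1), mul_neg_one, neg_smul, neg_neg]
    · rw [Finset.sum_apply, Finset.sum_apply]
      simp [fun k' => (ih k' p l).2]

theorem bd_bd_comm (E : ∀ i, Fin (f (i + 1)) → Fin (f i) → A)
    (Q : ∀ i, Fin (y (i + 1)) → Fin (y i) → A) (p q : ℕ)
    (u : Fin (y (q + 1)) → Fin (f (p + 1)) → A) (k : Fin (y q)) :
    bd Q q (fun k => bd E p (u k)) k = bd E p (bd Q q u k) := by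
  simp [bd_apply Q, map_sum]

/-- Let `A → R → A` be a retract, `D` the matrices of a complex of free `R`-modules that is exact
except that the cokernel of the first map is only assumed to be killed by the ideal `𝔪` of `A`.
Then, over `A`, every cycle with coordinates in `𝔪` is a boundary. The complex with matrices `Q`
is a free resolution of `A ⧸ 𝔪` over `A`. -/
theorem exists_boundary_of_retract (π : R →ₐ[A] A) {D : ∀ i, Fin (f (i + 1)) → Fin (f i) → R}
    (hD : IsCpx D) (𝔪 : Ideal A)
    (hex : ∀ n (x : Fin (f (n + 1)) → R), bd D n x = 0 → ∃ z, bd D (n + 1) z = x)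
    (hex₀ : ∀ x : Fin (f 0) → R, (∀ k, x k ∈ 𝔪.map (algebraMap A R)) → ∃ z, bd D 0 z = x)
    {Q : ∀ i, Fin (y (i + 1)) → Fin (y i) → A} (hQ : IsCpx Q) (hQ₀ : ∀ k l, Q 0 k l ∈ 𝔪)
    (hQex : ∀ n (x : Fin (y (n + 1)) → A), bd Q n x = 0 → ∃ z, bd Q (n + 1) z = x)
    (k₀ : Fin (y 0)) (hk₀ : ∀ a ∈ 𝔪, ∃ z, bd Q 0 z = Pi.single k₀ a)
    (n : ℕ) (c : Fin (f n) → A) (hc : ∀ k, c k ∈ 𝔪) (hcyc : IsCyc (fun i k l => π (D i k l)) n c) :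
    ∃ w, bd (fun i k l => π (D i k l)) n w = c := by
  obtain ⟨h, hh⟩ := exists_tot_section _ hex hex₀
  set E : ∀ i, Fin (f (i + 1)) → Fin (f i) → A := fun i k l => π (D i k l) with hE
  have hEc : IsCpx E := hD.map (π : R →+* A)
  let t : ∀ q, Fin (y q) → ∀ p, Fin (f p) → ∀ n, Fin (f n) → A :=
    fun q k p l n m => π (homotopySystem D h Q q k p l n m)
  have ht : ∀ q k p l, tot E (t (q + 1) k p l) =
      (-1 : A) ^ (q + 1) • famBd E (t (q + 1) k) p l + ∑ k', Q q k k' • t q k' p l := by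
    intro q k p l
    have h1 := (homotopySystem_spec hD hh hQ hQ₀ q k p l).1
    ext n m
    have h2 := congrArg π (congrFun (congrFun h1 n) m)
    have h3 : π (tot D (homotopySystem D h Q (q + 1) k p l) n m) = tot E (t (q + 1) k p l) n m := by
      simp [tot_apply, bd_apply, t, hE]
    rw [← h3, h2]
    cases p <;> simp [famBd, Finset.sum_apply, t, hE]
  -- The A-linear map Q_q ⊗ E_p → E induced by the homotopies after applying π.
  let ψ : ∀ q p, (Fin (y q) → Fin (f p) → A) → ∀ n, Fin (f n) → A :=
    fun q p u => ∑ k, ∑ l, u k l • t q k p l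
  have hψ₁ : ∀ q p (u : Fin (y (q + 1)) → Fin (f p) → A),
      ∑ k, ∑ l, u k l • ∑ k', Q q k k' • t q k' p l = ψ q p (bd Q q u) := by
    intro q p u
    simp only [ψ, bd_apply, Finset.sum_apply, Pi.smul_apply, Finset.smul_sum, Finset.sum_smul]
    rw [Finset.sum_congr rfl fun k _ => Finset.sum_comm, Finset.sum_comm]
    refine Finset.sum_congr rfl fun k' _ => ?_
    rw [Finset.sum_comm]
    refine Finset.sum_congr rfl fun l _ => Finset.sum_congr rfl fun k _ => ?_
    rw [smul_smul, smul_eq_mul, mul_comm]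
  have hψ : ∀ q p (u : Fin (y (q + 1)) → Fin (f (p + 1)) → A),
      tot E (ψ (q + 1) (p + 1) u) =
        (-1 : A) ^ (q + 1) • ψ (q + 1) p (fun k => bd E p (u k)) + ψ q (p + 1) (bd Q q u) := by
    intro q p u
    rw [← hψ₁]
    simp only [ψ, map_sum, map_smul, ht, famBd, smul_add, Finset.sum_add_distrib]
    congr 1
    simp only [bd_apply, Finset.smul_sum, Finset.sum_smul]
    refine Finset.sum_congr rfl fun k _ => ?_
    rw [Finset.sum_comm]
    refine Finset.sum_congr rfl fun l _ => Finset.sum_congr rfl fun m _ => ?_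
    simp only [smul_smul, smul_eq_mul]
    congr 1
    ring
  -- Staircase in the double complex Q ⊗ E: exactness of Q turns E(u) into Q(z) with z one step
  -- higher in Q and one step lower in E, until p = 0, where no E-differential is left.
  have claim : ∀ p q (u : Fin (y (q + 1)) → Fin (f p) → A),
      (∀ k, IsCyc E p (bd Q q u k)) → ∃ x, tot E x = ψ q p (bd Q q u) := by
    intro p
    induction p with
    | zero =>
      intro q u _
      refine ⟨ψ (q + 1) 0 u, ?_⟩
      rw [← hψ₁]
      simp only [ψ, map_sum, map_smul, ht, famBd, Pi.zero_apply, smul_zero, zero_add]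
    | succ p ih =>
      intro q u hu
      have H : ∀ m, ∃ z : Fin (y (q + 2)) → A, bd Q (q + 1) z = fun k => bd E p (u k) m := by
        intro m
        refine hQex q _ ?_
        ext k'
        have := congrFun (bd_bd_comm E Q p q u k') m
        rw [show bd E p (bd Q q u k') = 0 from hu k'] at this
        simpa [bd_apply Q] using this
      choose z hz using H
      have hz' : bd Q (q + 1) (fun k m => z m k) = fun k => bd E p (u k) := by
        ext k m
        have := congrFun (hz m) k
        rw [← this]
        simp [bd_apply]
      obtain ⟨x, hx⟩ := ih (q + 1) (fun k m => z m k) fun k => by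
        rw [hz']
        exact hEc.isCyc_bd _ _
      refine ⟨ψ (q + 1) (p + 1) u - (-1 : A) ^ (q + 1) • x, ?_⟩
      rw [map_sub, map_smul, hx, hψ, hz']
      abel
  -- Coordinates in 𝔪 make the cycle, placed at `k₀`, a Q-boundary; ψ on Q₀ acts there as the
  -- identity and returns `c`.
  choose z hz using fun l => hk₀ (c l) (hc l)
  have hz' : bd Q 0 (fun k l => z l k) = Pi.single k₀ c := by
    ext k l
    have := congrFun (hz l) k
    simp only [bd_apply, Finset.sum_apply, Pi.smul_apply] at this ⊢
    rw [this]
    rcases eq_or_ne k k₀ with rfl | hk <;> simp [*]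
  obtain ⟨x, hx⟩ := claim n 0 (fun k l => z l k) fun k => by
    rw [hz']
    rcases eq_or_ne k k₀ with rfl | hk
    · rwa [Pi.single_eq_same]
    · rw [Pi.single_eq_of_ne hk]
      cases n with
      | zero => trivial
      | succ n => exact map_zero (bd E n)
  refine ⟨x (n + 1), ?_⟩
  have h2 := congrFun hx n
  rw [tot_apply, hz'] at h2
  rw [h2]
  ext m
  simp only [ψ, Finset.sum_apply]
  rw [Finset.sum_eq_single k₀ (fun k _ hk => by simp [hk]) (by simp)]
  simp [t, homotopySystem, Pi.single_apply, apply_ite π]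

end Homotopy

/-! ### Iterated syzygies -/

section Syzygies

theorem bd_of_linearMap {A : Type*} [CommRing A] {f : ℕ → ℕ}
    (g : ∀ i, (Fin (f (i + 1)) → A) →ₗ[A] (Fin (f i) → A)) (i : ℕ) (w : Fin (f (i + 1)) → A) :
    bd (fun i k l => g i (Pi.single k 1) l) i w = g i w := by
  ext l
  rw [LinearMap.pi_apply_eq_sum_univ (g i) w, bd_apply, Finset.sum_apply]
  refine Finset.sum_congr rfl fun k _ => ?_
  rw [Pi.smul_apply, smul_eq_mul, smul_eq_mul, mul_comm]
  refine congrArg (fun v => w k * g i v l) ?_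
  ext j
  simp [Pi.single_apply, eq_comm]

theorem isCpx_of_linearMap {A : Type*} [CommRing A] {f : ℕ → ℕ}
    {g : ∀ i, (Fin (f (i + 1)) → A) →ₗ[A] (Fin (f i) → A)} (hg : ∀ i x, g i (g (i + 1) x) = 0) :
    IsCpx fun i k l => g i (Pi.single k 1) l := by
  intro i k m
  have h := congrFun (hg i (Pi.single k 1)) m
  rw [← bd_of_linearMap g, bd_apply] at h
  simpa [mul_comm] using h

/-- Dependent choice for syzygies: if every pair `(n, Z)` with property `P`, where `Z` is a
submodule of `A ^ n`, has a free cover whose kernel has property `P`, then the covers fit together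
to a resolution. -/
theorem exists_iterated_syzygies {A : Type*} [CommRing A]
    (P : (Σ n : ℕ, Submodule A (Fin n → A)) → Prop) (E : Set A)
    (step : ∀ z, P z → ∃ (m : ℕ) (g : (Fin m → A) →ₗ[A] (Fin z.1 → A)),
      LinearMap.range g = z.2 ∧ (∀ k l, g (Pi.single k 1) l ∈ E) ∧ P ⟨m, LinearMap.ker g⟩)
    (z₀ : Σ n : ℕ, Submodule A (Fin n → A)) (h₀ : P z₀) :
    ∃ (z : ℕ → Σ n : ℕ, Submodule A (Fin n → A))
      (g : ∀ i, (Fin (z (i + 1)).1 → A) →ₗ[A] (Fin (z i).1 → A)), z 0 = z₀ ∧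
      ∀ i, LinearMap.range (g i) = (z i).2 ∧ LinearMap.ker (g i) = (z (i + 1)).2 ∧
        ∀ k l, g i (Pi.single k 1) l ∈ E := by
  choose m g h₁ h₂ h₃ using step
  let z : ℕ → {z // P z} := fun i =>
    Nat.rec ⟨z₀, h₀⟩ (fun _ z => ⟨⟨m z.1 z.2, LinearMap.ker (g z.1 z.2)⟩, h₃ z.1 z.2⟩) i
  exact ⟨fun i => (z i).1, fun i => g (z i).1 (z i).2, rfl,
    fun i => ⟨h₁ _ _, rfl, h₂ _ _⟩⟩

theorem exact_of_syzygies {A : Type*} [CommRing A] {z : ℕ → Σ n : ℕ, Submodule A (Fin n → A)}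
    {g : ∀ i, (Fin (z (i + 1)).1 → A) →ₗ[A] (Fin (z i).1 → A)}
    (h₁ : ∀ i, LinearMap.range (g i) = (z i).2) (h₂ : ∀ i, LinearMap.ker (g i) = (z (i + 1)).2)
    (i : ℕ) : Function.Exact (g (i + 1)) (g i) :=
  LinearMap.exact_iff.2 ((h₂ i).trans (h₁ (i + 1)).symm)

/-- Over a noetherian ring, the residue ring `A ⧸ 𝔪` has a resolution by free modules of finite
rank; this removes the resolution from `exists_boundary_of_retract`. -/
theorem exists_boundary_of_retract_of_isNoetherianRing {A R : Type*} [CommRing A]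
    [IsNoetherianRing A] [CommRing R] [Algebra A R] {f : ℕ → ℕ} (π : R →ₐ[A] A)
    {D : ∀ i, Fin (f (i + 1)) → Fin (f i) → R} (hD : IsCpx D) (𝔪 : Ideal A)
    (hex : ∀ n (x : Fin (f (n + 1)) → R), bd D n x = 0 → ∃ z, bd D (n + 1) z = x)
    (hex₀ : ∀ x : Fin (f 0) → R, (∀ k, x k ∈ 𝔪.map (algebraMap A R)) → ∃ z, bd D 0 z = x)
    (n : ℕ) (c : Fin (f n) → A) (hc : ∀ k, c k ∈ 𝔪) (hcyc : IsCyc (fun i k l => π (D i k l)) n c) :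
    ∃ w, bd (fun i k l => π (D i k l)) n w = c := by
  obtain ⟨z, g, hz₀, hg⟩ := exists_iterated_syzygies (A := A) (fun _ => True) Set.univ (by
    rintro ⟨n, Z⟩ -
    obtain ⟨m, v, hv⟩ := Submodule.fg_iff_exists_fin_generating_family.1 (IsNoetherian.noetherian Z)
    exact ⟨m, Fintype.linearCombination A v, by rw [Fintype.range_linearCombination, hv],
      fun _ _ => trivial, trivial⟩)
    -- The chain of syzygies starts with 𝔪 inside A¹, so Q resolves A/𝔪.
    ⟨1, Submodule.comap (LinearMap.proj 0) 𝔪⟩ trivial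
  have hz : ∃ k₀ : Fin (z 0).1, (∀ a ∈ 𝔪, Pi.single k₀ a ∈ (z 0).2) ∧
      ∀ v ∈ (z 0).2, ∀ k, v k ∈ 𝔪 := by
    rw [hz₀]
    exact ⟨0, fun a ha => by simpa using ha, fun v hv k => by
      rw [Subsingleton.elim k 0]; exact hv⟩
  obtain ⟨k₀, hk₀, hmem⟩ := hz
  have hex' := exact_of_syzygies (fun i => (hg i).1) (fun i => (hg i).2.1)
  refine exists_boundary_of_retract π hD 𝔪 hex hex₀
    (Q := fun i k l => g i (Pi.single k 1) l) (y := fun i => (z i).1)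
    (isCpx_of_linearMap fun i x => (hex' i _).2 ⟨x, rfl⟩) (fun k l => hmem _ ?_ l)
    (fun n x hx => ?_) k₀ (fun a ha => ?_) n c hc hcyc
  · rw [← (hg 0).1]
    exact ⟨_, rfl⟩
  · rw [bd_of_linearMap] at hx
    obtain ⟨w, hw⟩ := (hex' n x).1 hx
    exact ⟨w, by rw [bd_of_linearMap, hw]⟩
  · have := hk₀ a ha
    rw [← (hg 0).1] at this
    obtain ⟨w, hw⟩ := this
    exact ⟨w, by rw [bd_of_linearMap, hw]⟩

end Syzygies

/-! ### Free covers and the long exact sequence -/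

section Cover

variable {B M : Type*} [CommRing B] [AddCommGroup M] [Module B M] {f : ℕ → ℕ}
  {D : ∀ i, Fin (f (i + 1)) → Fin (f i) → B}

theorem ExactIn.pi {m i : ℕ} {S T : Fin m → AddSubgroup M} (h : ∀ k, ExactIn D (S k) (T k) i) :
    ExactIn D (AddSubgroup.pi Set.univ S) (AddSubgroup.pi Set.univ T) i := by
  intro c hc hcyc
  have hcyc' : ∀ k, IsCyc D i fun l => c l k := fun k =>
    hcyc.map (q := (LinearMap.proj k : (Fin m → M) →ₗ[B] M).toAddMonoidHom)
      fun i w => bd_map D (LinearMap.proj k) i w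
  choose w hw hwc using fun k => h k _ (fun l => hc l k trivial) (hcyc' k)
  refine ⟨fun l k => w k l, fun l k _ => hw k l, ?_⟩
  ext l k
  rw [← congrFun (hwc k) l]
  simp [bd_apply]

/-- If `ℳ 0` is generated by `v` and the complex `D` is exact in homological degree `0`, then all
of `ℳ` is generated by `v`. -/
theorem exists_coeff_of_exactIn {𝒢 : ℕ → AddSubgroup B}
    (hmul : ∀ s, ∀ a ∈ 𝒢 1, ∀ b ∈ 𝒢 s, a * b ∈ 𝒢 (s + 1)) (hD₁ : ∀ i k l, D i k l ∈ 𝒢 1)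
    (l₀ : Fin (f 0)) {ℳ : ℕ → AddSubgroup M} (hex : ∀ s, ExactIn D (ℳ s) (ℳ (s + 1)) 0)
    {m : ℕ} {v : Fin m → M}
    (h₀ : ∀ x ∈ ℳ 0, ∃ r : Fin m → B, (∀ k, r k ∈ 𝒢 0) ∧ Fintype.linearCombination B v r = x)
    (s : ℕ) :
    ∀ x ∈ ℳ s, ∃ r : Fin m → B, (∀ k, r k ∈ 𝒢 s) ∧ Fintype.linearCombination B v r = x := by
  induction s with
  | zero => exact h₀
  | succ s ih =>
    intro x hx
    -- Every vector is a 0-cycle, so `x` placed at `l₀` is a boundary. Its `l₀`-coordinate writes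
    -- `x` as a combination of elements of ℳ s with coefficients in 𝒢 1.
    obtain ⟨w, hw, hwx⟩ := hex s (Pi.single l₀ x) (fun k => by
      rcases eq_or_ne k l₀ with rfl | hk
      · rwa [Pi.single_eq_same]
      · rw [Pi.single_eq_of_ne hk]; exact zero_mem _) trivial
    choose r hr hrw using fun k => ih (w k) (hw k)
    refine ⟨∑ k, D 0 k l₀ • r k, fun k => ?_, ?_⟩
    · rw [Finset.sum_apply]
      exact sum_mem fun k' _ => hmul s _ (hD₁ _ _ _) _ (hr _ _)
    · have := congrFun hwx l₀
      rw [Pi.single_eq_same, bd_apply] at this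
      rw [map_sum, ← this]
      exact Finset.sum_congr rfl fun k _ => by rw [map_smul, hrw]

/-- This is how linearity descends to syzygies: the kernel of a cover of ℳ passes the test one
degree higher. -/
theorem exactIn_ker_of_cover {𝒢 : ℕ → AddSubgroup B}
    (hmul : ∀ s, ∀ a ∈ 𝒢 1, ∀ b ∈ 𝒢 s, a * b ∈ 𝒢 (s + 1)) (hD₁ : ∀ i k l, D i k l ∈ 𝒢 1)
    (hD : IsCpx D) (hex𝒢 : ∀ s i, ExactIn D (𝒢 s) (𝒢 (s + 1)) i)
    {ℳ : ℕ → AddSubgroup M} (hex : ∀ s i, ExactIn D (ℳ s) (ℳ (s + 1)) i)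
    {m : ℕ} {v : Fin m → M} (hv : ∀ s, ∀ b ∈ 𝒢 s, ∀ k, b • v k ∈ ℳ s)
    (hcov : ∀ s, ∀ x ∈ ℳ s, ∃ r : Fin m → B, (∀ k, r k ∈ 𝒢 s) ∧
      Fintype.linearCombination B v r = x) (s i : ℕ) :
    ExactIn D
      (AddSubgroup.pi Set.univ (fun _ : Fin m => 𝒢 (s + 1)) ⊓
        (LinearMap.ker (Fintype.linearCombination B v)).toAddSubgroup)
      (AddSubgroup.pi Set.univ (fun _ : Fin m => 𝒢 (s + 2)) ⊓
        (LinearMap.ker (Fintype.linearCombination B v)).toAddSubgroup) i := by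
  refine ExactIn.ker (D' := D) hD (Fintype.linearCombination B v).toAddMonoidHom
    (fun i w => bd_map D (Fintype.linearCombination B v) i w)
    (G₀ := AddSubgroup.pi Set.univ (fun _ : Fin m => 𝒢 s)) (M₀ := ℳ s) (M₁ := ℳ (s + 1))
    (fun i => ExactIn.pi fun _ => hex𝒢 _ i) (hex s) (fun x hx => ?_) (fun y hy => ?_)
    (fun i w hw l k _ => ?_) i
  · change Fintype.linearCombination B v x ∈ _
    rw [Fintype.linearCombination_apply]
    exact sum_mem fun k _ => hv _ _ (hx k trivial) k
  · obtain ⟨r, hr, hry⟩ := hcov s y hy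
    exact ⟨r, fun k _ => hr k, hry⟩
  · rw [bd_apply, Finset.sum_apply]
    exact sum_mem fun k' _ => hmul s _ (hD₁ _ _ _) _ (hw k' k trivial)

end Cover

/-! ### Linear resolutions over the graded algebra -/

section GradedSyzygies

open DirectSum

variable {K A : Type*} [Field K] [CommRing A] [Algebra K A] (𝒜 : ℕ → Submodule K A)
  [GradedAlgebra 𝒜] {f : ℕ → ℕ} (E : ∀ i, Fin (f (i + 1)) → Fin (f i) → A)

/-- A homogeneous submodule of `A ^ n` that lives in positive degrees and is linear with respect to
the test complex `E`. -/
structure IsLinearSyzygy (z : Σ n : ℕ, Submodule A (Fin n → A)) : Prop where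
  proj_mem : ∀ v ∈ z.2, ∀ s, (fun k => (decompose 𝒜 (v k) s : A)) ∈ z.2
  eq_zero : ∀ v ∈ z.2, (∀ k, v k ∈ 𝒜 0) → v = 0
  exactIn : ∀ s i, ExactIn E
    (AddSubgroup.pi Set.univ (fun _ : Fin z.1 => (𝒜 (s + 1)).toAddSubgroup) ⊓ z.2.toAddSubgroup)
    (AddSubgroup.pi Set.univ (fun _ : Fin z.1 => (𝒜 (s + 2)).toAddSubgroup) ⊓ z.2.toAddSubgroup) i

variable {𝒜 E}

theorem mul_mem_succ (s : ℕ) (a : A) (ha : a ∈ (𝒜 1).toAddSubgroup) (b : A)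
    (hb : b ∈ (𝒜 s).toAddSubgroup) : a * b ∈ (𝒜 (s + 1)).toAddSubgroup := by
  have := SetLike.mul_mem_graded (A := 𝒜) ha hb
  rwa [add_comm] at this

/-- Linear independence over 𝒜 0 = K excludes relations in degree 0, so the relations start in
degree 1; `exactIn_ker_of_cover` gives the test. -/
theorem isLinearSyzygy_ker (h𝒜₀ : 𝒜 0 = 1) (hE₁ : ∀ i k l, E i k l ∈ 𝒜 1) (hE : IsCpx E)
    (l₀ : Fin (f 0))
    (hexA : ∀ s i, ExactIn E (𝒜 s).toAddSubgroup (𝒜 (s + 1)).toAddSubgroup i)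
    {M : Type*} [AddCommGroup M] [Module K M] [Module A M] [IsScalarTower K A M]
    {ℳ : ℕ → AddSubgroup M} (hex : ∀ s i, ExactIn E (ℳ s) (ℳ (s + 1)) i)
    {m : ℕ} {v : Fin m → M} (hli : LinearIndependent K v)
    (hspan : ∀ x ∈ ℳ 0, x ∈ Submodule.span K (Set.range v))
    (hv : ∀ s, ∀ b ∈ 𝒜 s, ∀ k, b • v k ∈ ℳ s)
    (hp : ∀ r : Fin m → A, Fintype.linearCombination A v r = 0 → ∀ s,
      Fintype.linearCombination A v (fun k => (decompose 𝒜 (r k) s : A)) = 0) :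
    IsLinearSyzygy 𝒜 E ⟨m, LinearMap.ker (Fintype.linearCombination A v)⟩ ∧
    ∀ s, ∀ x ∈ ℳ s, ∃ r : Fin m → A, (∀ k, r k ∈ 𝒜 s) ∧
      Fintype.linearCombination A v r = x := by
  have hcov := exists_coeff_of_exactIn (D := E) (𝒢 := fun s => (𝒜 s).toAddSubgroup) mul_mem_succ
    hE₁ l₀ (ℳ := ℳ) (fun s => hex s 0) (v := v) (fun x hx => by
      obtain ⟨c, hc⟩ := (Submodule.mem_span_range_iff_exists_fun K).1 (hspan x hx)
      refine ⟨fun k => algebraMap K A (c k), fun k => ?_, ?_⟩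
      · exact SetLike.algebraMap_mem_graded 𝒜 (c k)
      · rw [Fintype.linearCombination_apply, ← hc]
        simp)
  refine ⟨⟨fun r hr s => hp r hr s, fun r hr hr₀ => ?_, ?_⟩, hcov⟩
  · have H : ∀ k, ∃ c : K, algebraMap K A c = r k := fun k => by
      have := hr₀ k
      rw [h𝒜₀] at this
      exact Submodule.mem_one.1 this
    choose c hc using H
    have h1 : ∑ k, c k • v k = 0 := by
      rw [LinearMap.mem_ker, Fintype.linearCombination_apply] at hr
      rw [← hr]
      exact Finset.sum_congr rfl fun k _ => by rw [← hc, algebraMap_smul]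
    ext k
    rw [← hc, Fintype.linearIndependent_iff.1 hli c h1 k, map_zero]
    rfl
  · exact exactIn_ker_of_cover (𝒢 := fun s => (𝒜 s).toAddSubgroup) mul_mem_succ hE₁ hE hexA hex hv
      hcov

theorem exists_fin_basis {M : Type*} [AddCommGroup M] [Module K M] {V : Submodule K M}
    (hV : V.FG) :
    ∃ (m : ℕ) (v : Fin m → M), LinearIndependent K v ∧ Submodule.span K (Set.range v) = V := by
  have : Module.Finite K V := Module.Finite.iff_fg.2 hV
  let b := Module.finBasis K V
  refine ⟨_, fun k => (b k : M), b.linearIndependent.map' V.subtype (Submodule.ker_subtype V), ?_⟩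
  rw [show (Set.range fun k => (b k : M)) = V.subtype '' Set.range b by
    rw [← Set.range_comp]; rfl, Submodule.span_image, b.span_eq, Submodule.map_top,
    Submodule.range_subtype]

/-- A K-basis of the degree-1 part generates the syzygy module, by the test in homological degree 0,
and its relations form a linear syzygy module again. -/
theorem IsLinearSyzygy.exists_cover (h𝒜₀ : 𝒜 0 = 1) (hfg : (𝒜 1).FG)
    (hE₁ : ∀ i k l, E i k l ∈ 𝒜 1) (hE : IsCpx E) (l₀ : Fin (f 0))
    (hexA : ∀ s i, ExactIn E (𝒜 s).toAddSubgroup (𝒜 (s + 1)).toAddSubgroup i)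
    {z : Σ n : ℕ, Submodule A (Fin n → A)} (hz : IsLinearSyzygy 𝒜 E z) :
    ∃ (m : ℕ) (g : (Fin m → A) →ₗ[A] (Fin z.1 → A)),
      LinearMap.range g = z.2 ∧ (∀ k l, g (Pi.single k 1) l ∈ 𝒜 1) ∧
      IsLinearSyzygy 𝒜 E ⟨m, LinearMap.ker g⟩ := by
  classical
  obtain ⟨n, Z⟩ := z
  have hV : (Submodule.pi Set.univ (fun _ : Fin n => 𝒜 1) ⊓ Z.restrictScalars K).FG :=
    Submodule.FG.of_le (Submodule.fg_pi fun _ => hfg) inf_le_left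
  obtain ⟨m, v, hli, hspan⟩ := exists_fin_basis hV
  have hvV : ∀ k, (∀ l, v k l ∈ 𝒜 1) ∧ v k ∈ Z := fun k => by
    have : v k ∈ Submodule.span K (Set.range v) := Submodule.subset_span ⟨k, rfl⟩
    rw [hspan] at this
    exact ⟨fun l => this.1 l trivial, this.2⟩
  obtain ⟨h1, h2⟩ := isLinearSyzygy_ker h𝒜₀ hE₁ hE l₀ hexA hz.exactIn hli (fun x hx => by
      rw [hspan]; exact ⟨hx.1, hx.2⟩)
    (fun s b hb k => ⟨fun l _ => SetLike.mul_mem_graded hb ((hvV k).1 l), Z.smul_mem b (hvV k).2⟩)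
    (fun r hr s => by
      ext l
      have h3 := congrArg (GradedRing.proj 𝒜 (s + 1)) (congrFun hr l)
      simp only [Fintype.linearCombination_apply, Finset.sum_apply, Pi.smul_apply, smul_eq_mul,
        map_sum, Pi.zero_apply, map_zero] at h3 ⊢
      rw [← h3]
      exact Finset.sum_congr rfl fun k _ =>
        (coe_decompose_mul_add_of_right_mem 𝒜 ((hvV k).1 l)).symm)
  refine ⟨m, Fintype.linearCombination A v, le_antisymm ?_ fun x hx => ?_, fun k l => ?_, h1⟩
  · rw [Fintype.range_linearCombination, Submodule.span_le]
    rintro _ ⟨k, rfl⟩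
    exact (hvV k).2
  · let S : Finset ℕ := Finset.univ.biUnion fun l => (decompose 𝒜 (x l)).support
    have hx' : x = ∑ s ∈ S, fun l => (decompose 𝒜 (x l) s : A) := by
      ext l
      rw [Finset.sum_apply]
      conv_lhs => rw [← DirectSum.sum_support_decompose 𝒜 (x l)]
      refine Finset.sum_subset (fun s hs => Finset.mem_biUnion.2 ⟨l, Finset.mem_univ _, hs⟩)
        fun s _ hs => ?_
      rw [DFinsupp.notMem_support_iff.1 hs]
      rfl
    rw [hx']
    refine sum_mem fun s _ => ?_
    rcases s with _ | s
    -- The degree-0 component is homogeneous of degree 0 in the syzygy module, hence zero.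
    · rw [hz.eq_zero _ (hz.proj_mem x hx 0) fun k => SetLike.coe_mem _]
      exact zero_mem _
    · obtain ⟨r, -, hr⟩ := h2 s _
        ⟨fun k _ => (decompose 𝒜 (x k) (s + 1)).2, hz.proj_mem x hx (s + 1)⟩
      exact ⟨r, hr⟩
  · rw [Fintype.linearCombination_apply_single, one_smul]
    exact (hvV k).1 l

theorem IsLinearSyzygy.hasLinearResolution (h𝒜₀ : 𝒜 0 = 1) (hfg : (𝒜 1).FG)
    (hE₁ : ∀ i k l, E i k l ∈ 𝒜 1) (hE : IsCpx E) (l₀ : Fin (f 0))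
    (hexA : ∀ s i, ExactIn E (𝒜 s).toAddSubgroup (𝒜 (s + 1)).toAddSubgroup i)
    {M : Type*} [AddCommGroup M] [Module K M] [Module A M] {ℳ : ℕ → Submodule K M} {a n : ℕ}
    {ε : (Fin n → A) →ₗ[A] M} (hε : Function.Surjective ε) (hεa : ∀ k, ε (Pi.single k 1) ∈ ℳ a)
    (hz : IsLinearSyzygy 𝒜 E ⟨n, LinearMap.ker ε⟩) : HasLinearResolution 𝒜 ℳ a := by
  obtain ⟨z, g, hz₀, hg⟩ := exists_iterated_syzygies (IsLinearSyzygy 𝒜 E) (𝒜 1)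
    (fun z hz => hz.exists_cover h𝒜₀ hfg hE₁ hE l₀ hexA) _ hz
  have hε' : ∃ ε : (Fin (z 0).1 → A) →ₗ[A] M, Function.Surjective ε ∧
      (∀ k, ε (Pi.single k 1) ∈ ℳ a) ∧ LinearMap.ker ε = (z 0).2 := by
    rw [hz₀]
    exact ⟨ε, hε, hεa, rfl⟩
  obtain ⟨ε', h1, h2, h3⟩ := hε'
  exact ⟨{
    rank := fun i => (z i).1
    d := g
    ε := ε'
    d_mem := fun i => (hg i).2.2
    ε_mem := h2
    exact_d := exact_of_syzygies (fun i => (hg i).1) (fun i => (hg i).2.1)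
    exact_ε := LinearMap.exact_iff.2 (h3.trans (hg 0).1.symm)
    surjective_ε := h1 }⟩

end GradedSyzygies

/-! ### Retracts of bigraded algebras -/

section Bigraded

/-- A ring retract `A → R → A` of graded rings, where `R` carries a second grading, by the
`y`-degree, with components cut out by the projections `yp`, such that `A` is the part of
`y`-degree `0`, and such that elements of `𝒯 1` have `y`-degrees `0` and `1`. The projections onto
the components of the grading `𝒯` are called `tp`. -/
structure BigradedRetract {A R : Type*} [CommRing A] [CommRing R] [Algebra A R]
    (𝒜 : ℕ → AddSubgroup A) (𝒯 : ℕ → AddSubgroup R) where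
  π : R →ₐ[A] A
  yp : ℤ → R →+ R
  tp : ℕ → R →+ R
  π_mem : ∀ s, ∀ r ∈ 𝒯 s, π r ∈ 𝒜 s
  ι_mem : ∀ s, ∀ a ∈ 𝒜 s, algebraMap A R a ∈ 𝒯 s
  mul_mem : ∀ s, ∀ a ∈ 𝒯 1, ∀ r ∈ 𝒯 s, a * r ∈ 𝒯 (s + 1)
  tp_mem : ∀ s r, tp s r ∈ 𝒯 s
  tp_of_mem : ∀ s, ∀ r ∈ 𝒯 s, tp s r = r
  tp_mul : ∀ s, ∀ a ∈ 𝒯 1, ∀ r, tp (s + 1) (a * r) = a * tp s r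
  yp_mem : ∀ s j, ∀ r ∈ 𝒯 s, yp j r ∈ 𝒯 s
  yp_yp : ∀ j r, yp j (yp j r) = yp j r
  yp_mul : ∀ i j r v, yp i v = v → yp j (r * v) = yp (j - i) r * v
  yp_neg : ∀ j < 0, ∀ r, yp j r = 0
  yp_zero : ∀ r, yp 0 r = algebraMap A R (π r)
  yp_add : ∀ r ∈ 𝒯 1, yp 0 r + yp 1 r = r
  yp_eq_zero : ∀ r ∈ 𝒯 1, ∀ j, j ≠ 0 → j ≠ 1 → yp j r = 0

namespace BigradedRetract

variable {A R : Type*} [CommRing A] [CommRing R] [Algebra A R]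
  {𝒜 : ℕ → AddSubgroup A} {𝒯 : ℕ → AddSubgroup R} (S : BigradedRetract 𝒜 𝒯) {f : ℕ → ℕ}

/-- The elements of `y`-degree `j`. -/
def yDeg (j : ℤ) : AddSubgroup R where
  carrier := {r | S.yp j r = r}
  zero_mem' := map_zero _
  add_mem' {a b} ha hb := by
    change S.yp j (a + b) = a + b
    rw [map_add, show S.yp j a = a from ha, show S.yp j b = b from hb]
  neg_mem' {a} ha := by
    change S.yp j (-a) = -a
    rw [map_neg, show S.yp j a = a from ha]

theorem mem_yDeg {j : ℤ} {r : R} : r ∈ S.yDeg j ↔ S.yp j r = r := Iff.rfl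

theorem yp_mem_yDeg (j : ℤ) (r : R) : S.yp j r ∈ S.yDeg j := S.yp_yp j r

theorem mul_mem_yDeg {i j : ℤ} {r v : R} (hr : r ∈ S.yDeg (j - i)) (hv : v ∈ S.yDeg i) :
    r * v ∈ S.yDeg j := by
  rw [mem_yDeg, S.yp_mul i j r v hv, hr]

theorem algebraMap_mem_yDeg (a : A) : algebraMap A R a ∈ S.yDeg 0 := by
  rw [mem_yDeg, S.yp_zero, S.π.commutes]
  rfl

/-- The elements of bidegree `(s, j)` of a free module whose `k`-th basis vector has `y`-degree
`b k`. -/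
def biDeg {m : ℕ} (b : Fin m → ℤ) (s : ℕ) (j : ℤ) : AddSubgroup (Fin m → R) :=
  AddSubgroup.pi Set.univ fun k => 𝒯 s ⊓ S.yDeg (j - b k)

theorem smul_mem_inf_yDeg {s : ℕ} {j : ℤ} {a : A} (ha : a ∈ 𝒜 1) {r : R} (hr : r ∈ 𝒯 s ⊓ S.yDeg j) :
    a • r ∈ 𝒯 (s + 1) ⊓ S.yDeg j := by
  rw [Algebra.smul_def]
  refine ⟨S.mul_mem _ _ (S.ι_mem _ _ ha) _ hr.1, ?_⟩
  exact S.mul_mem_yDeg (by rw [sub_self]; exact S.algebraMap_mem_yDeg a) hr.2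

theorem bd_mem_biDeg {E : ∀ i, Fin (f (i + 1)) → Fin (f i) → A} (hE : ∀ i k l, E i k l ∈ 𝒜 1)
    {m : ℕ} {b : Fin m → ℤ} {s : ℕ} {j : ℤ} {i : ℕ} {w : Fin (f (i + 1)) → Fin m → R}
    (hw : ∀ k, w k ∈ S.biDeg b s j) (l : Fin (f i)) : bd E i w l ∈ S.biDeg b (s + 1) j := by
  rw [bd_apply]
  exact sum_mem fun k _ n _ => S.smul_mem_inf_yDeg (hE _ _ _) (hw k n trivial)

/-- A bihomogeneous submodule of a free `R`-module that lives in positive `y`-degrees and is linear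
with respect to the test complex `D`. -/
structure IsSyzygy (D : ∀ i, Fin (f (i + 1)) → Fin (f i) → R) {m : ℕ} (b : Fin m → ℤ)
    (N : Submodule R (Fin m → R)) : Prop where
  yp_mem : ∀ v ∈ N, ∀ j, (fun k => S.yp (j - b k) (v k)) ∈ N
  eq_zero : ∀ v ∈ N, ∀ j ≤ 0, ∀ k, S.yp (j - b k) (v k) = 0
  exactIn : ∀ s i, ExactIn D
    (AddSubgroup.pi Set.univ (fun _ : Fin m => 𝒯 (s + 1)) ⊓ N.toAddSubgroup)
    (AddSubgroup.pi Set.univ (fun _ : Fin m => 𝒯 (s + 2)) ⊓ N.toAddSubgroup) i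

variable {S}

/-- The bihomogeneous elements of total degree 1 and positive y-degree suffice, and noetherianity
makes finitely many enough. Minimality is not needed, since the test ignores relations of total
degree 0. -/
theorem IsSyzygy.exists_generators [IsNoetherianRing R]
    {D : ∀ i, Fin (f (i + 1)) → Fin (f i) → R} {m : ℕ}
    {b : Fin m → ℤ} {N : Submodule R (Fin m → R)} (hN : S.IsSyzygy D b N) :
    ∃ (m' : ℕ) (b' : Fin m' → ℤ) (v : Fin m' → Fin m → R),
      (∀ k, 0 < b' k ∧ v k ∈ N ∧ v k ∈ S.biDeg b 1 (b' k)) ∧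
      ∀ x ∈ N, (∀ k, x k ∈ 𝒯 1) → x ∈ Submodule.span R (Set.range v) := by
  let X : Set (Fin m → R) := {v | v ∈ N ∧ ∃ j : ℤ, 0 < j ∧ v ∈ S.biDeg b 1 j}
  obtain ⟨X', hX', hspan⟩ := (Submodule.fg_span_iff_fg_span_finset_subset X).1
    (IsNoetherian.noetherian (Submodule.span R X))
  have H : ∀ k : Fin X'.card, ∃ j : ℤ, 0 < j ∧ (X'.equivFin.symm k : Fin m → R) ∈ S.biDeg b 1 j :=
    fun k => (hX' (X'.equivFin.symm k).2).2
  choose b' hb' hv using H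
  refine ⟨_, b', fun k => X'.equivFin.symm k, fun k =>
    ⟨hb' k, (hX' (X'.equivFin.symm k).2).1, hv k⟩, fun x hx hx₁ => ?_⟩
  have hr : (Set.range fun k => (X'.equivFin.symm k : Fin m → R)) = (X' : Set (Fin m → R)) := by
    ext v
    constructor
    · rintro ⟨k, rfl⟩
      exact (X'.equivFin.symm k).2
    · intro hv
      exact ⟨X'.equivFin ⟨v, hv⟩, by simp⟩
  rw [hr, ← hspan]
  -- Coordinates in 𝒯 1 have y-degrees 0 and 1 only, so after the shift by `b k` just these weights
  -- occur.
  let J : Finset ℤ := Finset.univ.biUnion fun k => {b k, b k + 1}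
  have hsum : x = ∑ j ∈ J, fun k => S.yp (j - b k) (x k) := by
    ext k
    have hsub : ({b k, b k + 1} : Finset ℤ) ⊆ J :=
      Finset.subset_biUnion_of_mem (fun k => ({b k, b k + 1} : Finset ℤ)) (Finset.mem_univ k)
    rw [Finset.sum_apply, ← Finset.sum_subset hsub fun j _ hj => ?_,
      Finset.sum_pair (by omega), sub_self, add_sub_cancel_left, S.yp_add _ (hx₁ k)]
    simp only [Finset.mem_insert, Finset.mem_singleton, not_or] at hj
    exact S.yp_eq_zero _ (hx₁ k) _ (by omega) (by omega)
  rw [hsum]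
  refine sum_mem fun j _ => ?_
  rcases le_or_gt j 0 with hj | hj
  · rw [show (fun k => S.yp (j - b k) (x k)) = 0 from funext fun k => hN.eq_zero x hx j hj k]
    exact zero_mem _
  · exact Submodule.subset_span ⟨hN.yp_mem x hx j, j, hj, fun k _ =>
      ⟨S.yp_mem _ _ _ (hx₁ k), S.yp_mem_yDeg _ _⟩⟩

theorem IsSyzygy.exists_cover [IsNoetherianRing R] {D : ∀ i, Fin (f (i + 1)) → Fin (f i) → R}
    (hD : IsCpx D) (hD₁ : ∀ i k l, D i k l ∈ 𝒯 1) (l₀ : Fin (f 0))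
    (hexR : ∀ s i, ExactIn D (𝒯 s) (𝒯 (s + 1)) i) {m : ℕ}
    {b : Fin m → ℤ} {N : Submodule R (Fin m → R)} (hN : S.IsSyzygy D b N) :
    ∃ (m' : ℕ) (b' : Fin m' → ℤ) (v : Fin m' → Fin m → R), (∀ k, 0 < b' k) ∧
      S.IsSyzygy D b' (LinearMap.ker (Fintype.linearCombination R v)) ∧
      (∀ s j, ∀ x ∈ S.biDeg b' s j,
        Fintype.linearCombination R v x ∈ S.biDeg b (s + 1) j ⊓ N.toAddSubgroup) ∧
      ∀ s j, ∀ y ∈ S.biDeg b (s + 1) j ⊓ N.toAddSubgroup,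
        ∃ x ∈ S.biDeg b' s j, Fintype.linearCombination R v x = y := by
  obtain ⟨m', b', v, hv, hspan⟩ := hN.exists_generators
  have hcov := exists_coeff_of_exactIn S.mul_mem hD₁ l₀ (v := v)
    (ℳ := fun s => AddSubgroup.pi Set.univ (fun _ : Fin m => 𝒯 (s + 1)) ⊓ N.toAddSubgroup)
    (fun s => hN.exactIn s 0) fun x hx => by
      obtain ⟨r, hr⟩ := (Submodule.mem_span_range_iff_exists_fun R).1
        (hspan x hx.2 fun k => hx.1 k trivial)
      -- The coefficients may be inhomogeneous; as `x` and the generators have total degree 1, the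
      -- degree-0 parts already represent `x`.
      refine ⟨fun k => S.tp 0 (r k), fun k => S.tp_mem _ _, ?_⟩
      ext l
      rw [← S.tp_of_mem 1 (x l) (hx.1 l trivial), ← hr, Fintype.linearCombination_apply,
        Finset.sum_apply, Finset.sum_apply, map_sum]
      refine Finset.sum_congr rfl fun k _ => ?_
      rw [Pi.smul_apply, Pi.smul_apply, smul_eq_mul, smul_eq_mul, mul_comm (r k),
        S.tp_mul 0 _ ((hv k).2.2 l trivial).1, mul_comm]
  have hyp : ∀ (r : Fin m' → R) (j : ℤ) (l : Fin m),
      Fintype.linearCombination R v (fun k => S.yp (j - b' k) (r k)) l =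
        S.yp (j - b l) (Fintype.linearCombination R v r l) := by
    intro r j l
    simp only [Fintype.linearCombination_apply, Finset.sum_apply, map_sum, Pi.smul_apply,
      smul_eq_mul]
    refine Finset.sum_congr rfl fun k _ => ?_
    rw [S.yp_mul (b' k - b l) _ _ _ ((hv k).2.2 l trivial).2, sub_sub_sub_cancel_right]
  refine ⟨m', b', v, fun k => (hv k).1, ⟨fun r hr j => ?_, fun r _ j hj k => ?_, ?_⟩,
    fun s j x hx => ⟨fun l _ => ?_, ?_⟩, fun s j y hy => ?_⟩
  · ext l
    rw [hyp, show Fintype.linearCombination R v r = 0 from hr]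
    simp
  · exact S.yp_neg _ (by have := (hv k).1; omega) _
  · refine exactIn_ker_of_cover S.mul_mem hD₁ hD hexR hN.exactIn (fun s r hr k => ?_) hcov
    refine ⟨fun l _ => ?_, N.smul_mem r (hv k).2.1⟩
    change r * v k l ∈ 𝒯 (s + 1)
    rw [mul_comm]
    exact S.mul_mem s _ ((hv k).2.2 l trivial).1 r hr
  · rw [Fintype.linearCombination_apply, Finset.sum_apply]
    refine sum_mem fun k _ => AddSubgroup.mem_inf.2 ⟨?_, ?_⟩
    · rw [Pi.smul_apply, smul_eq_mul, mul_comm]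
      exact S.mul_mem s _ ((hv k).2.2 l trivial).1 _ (hx k trivial).1
    · refine S.mul_mem_yDeg (i := b' k - b l) ?_ ((hv k).2.2 l trivial).2
      rw [sub_sub_sub_cancel_right]
      exact (hx k trivial).2
  · rw [Fintype.linearCombination_apply]
    exact sum_mem fun k _ => N.smul_mem _ (hv k).2.1
  · obtain ⟨r, hr, hry⟩ := hcov s y ⟨fun k _ => (hy.1 k trivial).1, hy.2⟩
    refine ⟨fun k => S.yp (j - b' k) (r k), fun k _ =>
      ⟨S.yp_mem _ _ _ (hr k), S.yp_mem_yDeg _ _⟩, ?_⟩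
    ext l
    rw [hyp, hry]
    exact (hy.1 l trivial).2

/-- In y-degree j the free cover is a sum of strands of R of y-degree less than j, where E is exact
by `hj`. The long exact sequence then trades exactness at i for exactness of the kernel at i - 1. -/
theorem IsSyzygy.exactIn_biDeg [IsNoetherianRing R] {D : ∀ i, Fin (f (i + 1)) → Fin (f i) → R}
    (hD : IsCpx D) (hD₁ : ∀ i k l, D i k l ∈ 𝒯 1) (l₀ : Fin (f 0))
    (hexR : ∀ s i, ExactIn D (𝒯 s) (𝒯 (s + 1)) i) {E : ∀ i, Fin (f (i + 1)) → Fin (f i) → A}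
    (hE : IsCpx E) (hE₁ : ∀ i k l, E i k l ∈ 𝒜 1) {j : ℤ}
    (hj : ∀ j' < j, ∀ s : ℕ, j' ≤ s → ∀ i,
      ExactIn E (𝒯 s ⊓ S.yDeg j') (𝒯 (s + 1) ⊓ S.yDeg j') i) (i : ℕ) :
    ∀ {m : ℕ} {b : Fin m → ℤ} {N : Submodule R (Fin m → R)}, S.IsSyzygy D b N →
      ∀ s : ℕ, j ≤ s → ExactIn E (S.biDeg b s j ⊓ N.toAddSubgroup)
        (S.biDeg b (s + 1) j ⊓ N.toAddSubgroup) i := by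
  induction i using Nat.strong_induction_on with
  | _ i ih =>
  intro m b N hN s hs
  -- For s = 0 one has j ≤ 0, and the module lives in positive y-degrees.
  rcases s with _ | s
  · intro c hc _
    refine ⟨0, fun _ => zero_mem _, ?_⟩
    rw [map_zero]
    ext k l
    have := ((hc k).1 l trivial).2
    rw [← show S.yp (j - b l) (c k l) = c k l from this,
      hN.eq_zero _ (hc k).2 j (by simpa using hs) l]
    rfl
  · obtain ⟨m', b', v, hb', hker, h₀, h₁⟩ := hN.exists_cover hD hD₁ l₀ hexR
    refine ExactIn.of_surjective (D := E) (D' := E) hE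
      (Fintype.linearCombination R v).toAddMonoidHom
      (fun i w => bd_map E ((Fintype.linearCombination R v).restrictScalars A) i w)
      (G₀ := S.biDeg b' s j) (G₁ := S.biDeg b' (s + 1) j) (G₂ := S.biDeg b' (s + 2) j)
      (ExactIn.pi fun k => hj _ ?_ s ?_ i) ?_ (h₀ s j) (h₁ (s + 1) j)
      (fun i w hw => S.bd_mem_biDeg hE₁ hw)
    -- A generator costs one total degree and at least one y-degree, so the bound between them
    -- persists.
    · have := hb' k; omega
    · have := hb' k; push_cast at hs; omega
    · rintro i' rfl
      exact ih i' (Nat.lt_succ_self i') hker (s + 1) hs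

variable (S)

theorem yp_yp_of_lt {i j : ℤ} (hij : i < j) (r : R) : S.yp i (S.yp j r) = 0 := by
  have := S.yp_mul j i 1 (S.yp j r) (S.yp_yp j r)
  rwa [one_mul, S.yp_neg (i - j) (by omega), zero_mul] at this

theorem π_eq_zero_iff (r : R) : S.π r = 0 ↔ S.yp 0 r = 0 := by
  rw [S.yp_zero]
  constructor
  · intro h
    rw [h, map_zero]
  · intro h
    have := congrArg S.π h
    rwa [S.π.commutes, map_zero] at this

theorem yp_zero_yp {r : R} (hr : S.π r = 0) (j : ℤ) : S.yp 0 (S.yp j r) = 0 := by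
  rcases lt_trichotomy j 0 with hj | rfl | hj
  · rw [S.yp_neg j hj, map_zero]
  · rw [S.yp_yp, ← S.π_eq_zero_iff, hr]
  · exact S.yp_yp_of_lt hj r

/-- The long exact sequence of 0 → ker π → R → A → 0; π kills exactly the positive y-degrees. -/
theorem isSyzygy_ker {D : ∀ i, Fin (f (i + 1)) → Fin (f i) → R} (hD : IsCpx D)
    (hD₁ : ∀ i k l, D i k l ∈ 𝒯 1) (hexR : ∀ s i, ExactIn D (𝒯 s) (𝒯 (s + 1)) i)
    (hexA : ∀ s i, ExactIn (fun i k l => S.π (D i k l)) (𝒜 s) (𝒜 (s + 1)) i) :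
    S.IsSyzygy D (0 : Fin 1 → ℤ) (Submodule.comap (LinearMap.proj 0) (RingHom.ker S.π)) := by
  refine ⟨fun v hv j => ?_, fun v hv j hj k => ?_, fun s i => ?_⟩
  · change S.π (S.yp (j - 0) (v 0)) = 0
    rw [π_eq_zero_iff, sub_zero]
    exact S.yp_zero_yp hv j
  · rw [Subsingleton.elim k 0]
    simp only [Pi.zero_apply, sub_zero]
    rcases hj.lt_or_eq with hj | rfl
    · exact S.yp_neg j hj _
    · exact (S.π_eq_zero_iff _).1 hv
  · refine ExactIn.ker (D' := fun i k l => S.π (D i k l)) hD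
      ((S.π : R →+* A).toAddMonoidHom.comp (LinearMap.proj (0 : Fin 1) : _ →ₗ[R] R).toAddMonoidHom)
      (fun i w => ?_) (G₀ := AddSubgroup.pi Set.univ fun _ => 𝒯 s) (M₀ := 𝒜 s) (M₁ := 𝒜 (s + 1))
      (fun i => ExactIn.pi fun _ => hexR _ i) (hexA s) (fun x hx => S.π_mem _ _ (hx 0 trivial))
      (fun y hy => ⟨fun _ => algebraMap A R y, fun _ _ => S.ι_mem _ _ hy, S.π.commutes y⟩)
      (fun i w hw l k _ => ?_) i
    · ext l
      simp [bd_apply]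
    · rw [bd_apply, Finset.sum_apply]
      exact sum_mem fun k' _ => S.mul_mem _ _ (hD₁ _ _ _) _ (hw k' k trivial)

/-- If the test complex is exact on `R` and on its retract `A`, then it is exact on the components
of `R` of fixed `y`-degree. -/
theorem exactIn_yDeg [IsNoetherianRing R] {D : ∀ i, Fin (f (i + 1)) → Fin (f i) → R}
    (hD : IsCpx D) (hD₁ : ∀ i k l, D i k l ∈ 𝒯 1) (l₀ : Fin (f 0))
    (hexR : ∀ s i, ExactIn D (𝒯 s) (𝒯 (s + 1)) i)
    (hexA : ∀ s i, ExactIn (fun i k l => S.π (D i k l)) (𝒜 s) (𝒜 (s + 1)) i) (n : ℕ) :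
    ∀ j < (n : ℤ), ∀ s : ℕ, j ≤ s → ∀ i, ExactIn (fun i k l => S.π (D i k l))
      (𝒯 s ⊓ S.yDeg j) (𝒯 (s + 1) ⊓ S.yDeg j) i := by
  induction n with
  | zero =>
    intro j hj s _ i c hc _
    refine ⟨0, fun _ => zero_mem _, ?_⟩
    rw [map_zero]
    ext k
    rw [← show S.yp j (c k) = c k from (hc k).2, S.yp_neg j (by simpa using hj)]
    rfl
  | succ n ih =>
    intro j hj s hs i
    rcases (show j ≤ n by push_cast at hj; omega).lt_or_eq with hj' | hjn
    · exact ih j hj' s hs i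
    intro c hc hcyc
    -- The strand of y-degree 0 is A itself; a strand of positive y-degree lies in ker π.
    rcases Nat.eq_zero_or_pos n with rfl | hn
    · obtain rfl : j = 0 := by simpa using hjn
      obtain ⟨w, hw, hwc⟩ := hexA s i (fun k => S.π (c k)) (fun k => S.π_mem _ _ (hc k).1)
        (hcyc.map (q := S.π.toLinearMap.toAddMonoidHom) fun i w => bd_map _ S.π.toLinearMap i w)
      refine ⟨fun k => algebraMap A R (w k), fun k =>
        ⟨S.ι_mem _ _ (hw k), S.algebraMap_mem_yDeg _⟩, ?_⟩
      have h1 := bd_map (fun i k l => S.π (D i k l)) (Algebra.linearMap A R) i w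
      refine h1.symm.trans ?_
      ext k
      rw [hwc, Algebra.linearMap_apply, ← S.yp_zero]
      exact (hc k).2
    · have hN := S.isSyzygy_ker hD hD₁ hexR hexA
      have h0 : ∀ k, S.π (c k) = 0 := fun k => by
        rw [π_eq_zero_iff, ← show S.yp j (c k) = c k from (hc k).2]
        exact S.yp_yp_of_lt (by omega) _
      obtain ⟨w, hw, hwc⟩ := hN.exactIn_biDeg hD hD₁ l₀ hexR (hD.map (S.π : R →+* A))
        (fun i k l => S.π_mem _ _ (hD₁ i k l)) (fun j' hj' => ih j' (hjn ▸ hj')) i s hs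
        (fun k _ => c k) (fun k => ⟨fun _ _ => by simpa using hc k, h0 k⟩) (by
          cases i with
          | zero => trivial
          | succ i =>
            ext l x
            have := congrFun hcyc l
            simpa [bd_apply] using this)
      refine ⟨fun k => w k 0, fun k => by simpa using (hw k).1 0 trivial, ?_⟩
      ext l
      have := congrFun (congrFun hwc l) 0
      simpa [bd_apply] using this

end BigradedRetract

end Bigraded

/-! ### The Rees ring as a bigraded retract -/

section Rees

open DirectSum Polynomial

variable {K A : Type*} [Field K] [CommRing A] [Algebra K A] {𝒜 : ℕ → Submodule K A}
  {I : Ideal A} {d : ℕ}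

variable (𝒜 I d) in
/-- Total degree in the Rees ring in terms of coefficients. -/
theorem mem_reesGrading_iff (s : ℕ) (r : reesAlgebra I) :
    r ∈ reesGrading 𝒜 I d s ↔ ∀ j, (j ≤ s → (r : A[X]).coeff j ∈ 𝒜 (s - j + d * j)) ∧
      (s < j → (r : A[X]).coeff j = 0) := by
  constructor
  · intro hr
    refine Submodule.iSup_induction'
      (fun p => ⨆ (_ : p ∈ Finset.HasAntidiagonal.antidiagonal s), reesBigrading 𝒜 I d p)
      (motive := fun r _ => ∀ j,
        (j ≤ s → (r : A[X]).coeff j ∈ 𝒜 (s - j + d * j)) ∧ (s < j → (r : A[X]).coeff j = 0))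
      (fun p r hr => ?_) ?_ ?_ hr
    · refine Submodule.iSup_induction'
        (fun _ : p ∈ Finset.HasAntidiagonal.antidiagonal s => reesBigrading 𝒜 I d p)
        (motive := fun r _ => ∀ j,
          (j ≤ s → (r : A[X]).coeff j ∈ 𝒜 (s - j + d * j)) ∧ (s < j → (r : A[X]).coeff j = 0))
        (fun hp r hr j => ?_) ?_ ?_ hr
      · obtain ⟨c, hc, hcr⟩ := hr
        rw [Finset.HasAntidiagonal.mem_antidiagonal] at hp
        change monomial p.2 c = (r : A[X]) at hcr
        rw [← hcr, coeff_monomial]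
        split_ifs with h
        · subst h
          exact ⟨fun _ => by rwa [← hp, Nat.add_sub_cancel], fun _ => by omega⟩
        · exact ⟨fun _ => zero_mem _, fun _ => rfl⟩
      · simp
      · intro x y _ _ hx hy j
        refine ⟨fun h => ?_, fun h => ?_⟩
        · exact add_mem ((hx j).1 h) ((hy j).1 h)
        · simp [(hx j).2 h, (hy j).2 h]
    · simp
    · intro x y _ _ hx hy j
      refine ⟨fun h => ?_, fun h => ?_⟩
      · exact add_mem ((hx j).1 h) ((hy j).1 h)
      · simp [(hx j).2 h, (hy j).2 h]
  · intro h
    have hmem : ∀ j, monomial j ((r : A[X]).coeff j) ∈ reesAlgebra I := fun j =>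
      reesAlgebra.monomial_mem.2 ((mem_reesAlgebra_iff I _).1 r.2 j)
    have hr : r = ∑ j ∈ Finset.range (s + 1), ⟨monomial j ((r : A[X]).coeff j), hmem j⟩ := by
      ext n
      rw [AddSubmonoidClass.coe_finsetSum, finsetSum_coeff]
      simp only [coeff_monomial, Finset.sum_ite_eq', Finset.mem_range]
      split_ifs with hn
      · rfl
      · exact (h n).2 (by omega)
    rw [hr]
    refine sum_mem fun j hj => ?_
    rw [Finset.mem_range] at hj
    refine Submodule.mem_iSup_of_mem (s - j, j) (Submodule.mem_iSup_of_mem ?_ ?_)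
    · rw [Finset.HasAntidiagonal.mem_antidiagonal]
      omega
    · exact ⟨_, (h j).1 (by omega), rfl⟩

variable [GradedAlgebra 𝒜]

theorem IsGeneratedInDegree.pow (hI : IsGeneratedInDegree 𝒜 I d) (j : ℕ) :
    IsGeneratedInDegree 𝒜 (I ^ j) (d * j) := by
  induction j with
  | zero =>
    refine ⟨{1}, ?_, by simp⟩
    simpa using SetLike.one_mem_graded 𝒜
  | succ j ih =>
    obtain ⟨s, hs, hsI⟩ := hI
    obtain ⟨t, ht, htI⟩ := ih
    refine ⟨Set.image2 (· * ·) t s, ?_, ?_⟩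
    · rintro _ ⟨x, hx, y, hy, rfl⟩
      exact SetLike.mul_mem_graded (ht hx) (hs hy)
    · rw [pow_succ, htI, hsI, Ideal.span_mul_span', Set.image2_mul]

theorem IsGeneratedInDegree.decompose_mem (hI : IsGeneratedInDegree 𝒜 I d) {x : A} (hx : x ∈ I)
    (k : ℕ) : (decompose 𝒜 x k : A) ∈ I := by
  obtain ⟨s, hs, rfl⟩ := hI
  exact Ideal.homogeneous_span 𝒜 s (fun y hy => ⟨d, hs hy⟩) k hx

theorem IsGeneratedInDegree.decompose_eq_zero (hI : IsGeneratedInDegree 𝒜 I d) {x : A} (hx : x ∈ I)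
    {k : ℕ} (hk : k < d) : (decompose 𝒜 x k : A) = 0 := by
  obtain ⟨s, hs, rfl⟩ := hI
  obtain ⟨n, a, g, rfl⟩ := Submodule.mem_span_set'.1 hx
  change GradedRing.proj 𝒜 k _ = 0
  rw [map_sum]
  exact Finset.sum_eq_zero fun i _ =>
    coe_decompose_mul_of_right_mem_of_not_le 𝒜 (hs (g i).2) hk.not_ge

/-- The component of `y`-degree `j`, that is the monomial part of degree `j`. -/
noncomputable def reesProj (I : Ideal A) (j : ℤ) : reesAlgebra I →+ reesAlgebra I where
  toFun r := if 0 ≤ j then ⟨monomial j.toNat ((r : A[X]).coeff j.toNat),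
    reesAlgebra.monomial_mem.2 ((mem_reesAlgebra_iff I _).1 r.2 _)⟩ else 0
  map_zero' := by
    split_ifs
    · ext1; simp
    · rfl
  map_add' x y := by
    split_ifs
    · ext1; simp
    · simp

theorem coe_reesProj_natCast (n : ℕ) (r : reesAlgebra I) :
    (reesProj I n r : A[X]) = monomial n ((r : A[X]).coeff n) := by
  simp [reesProj]

theorem reesProj_of_neg {j : ℤ} (hj : j < 0) (r : reesAlgebra I) : reesProj I j r = 0 := by
  simp [reesProj, hj]

theorem reesProj_mul (i j : ℤ) (r v : reesAlgebra I) (hv : reesProj I i v = v) :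
    reesProj I j (r * v) = reesProj I (j - i) r * v := by
  rcases lt_or_ge i 0 with hi | hi
  · rw [reesProj_of_neg hi] at hv
    rw [← hv, mul_zero, mul_zero, map_zero]
  rcases lt_or_ge j 0 with hj | hj
  · rw [reesProj_of_neg hj, reesProj_of_neg (by omega), zero_mul]
  lift i to ℕ using hi
  lift j to ℕ using hj
  have hv' := congrArg Subtype.val hv
  rw [coe_reesProj_natCast] at hv'
  ext1
  rw [coe_reesProj_natCast, MulMemClass.coe_mul, MulMemClass.coe_mul]
  rw [← hv']
  rcases lt_or_ge j i with hij | hij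
  · have h0 : ((r : A[X]) * monomial i ((v : A[X]).coeff i)).coeff j = 0 := by
      rw [← C_mul_X_pow_eq_monomial, ← mul_assoc, coeff_mul_X_pow', if_neg (by omega)]
    rw [reesProj_of_neg (by omega), h0]
    simp
  · obtain ⟨k, rfl⟩ := Nat.exists_eq_add_of_le' hij
    rw [coeff_mul_monomial, Nat.cast_add, add_sub_cancel_right, coe_reesProj_natCast,
      monomial_mul_monomial]

/-- The component of total degree `s`. -/
noncomputable def reesTotalProj (hI : IsGeneratedInDegree 𝒜 I d) (s : ℕ) :
    reesAlgebra I →+ reesAlgebra I where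
  toFun r := ⟨∑ j ∈ Finset.range (s + 1),
      monomial j (decompose 𝒜 ((r : A[X]).coeff j) (s - j + d * j) : A), sum_mem fun j _ =>
    reesAlgebra.monomial_mem.2 ((hI.pow j).decompose_mem ((mem_reesAlgebra_iff I _).1 r.2 j) _)⟩
  map_zero' := by
    ext1; simp
  map_add' x y := by
    ext1
    simp [Finset.sum_add_distrib]

theorem coeff_reesTotalProj (hI : IsGeneratedInDegree 𝒜 I d) (s n : ℕ) (r : reesAlgebra I) :
    (reesTotalProj hI s r : A[X]).coeff n =
      if n ≤ s then (decompose 𝒜 ((r : A[X]).coeff n) (s - n + d * n) : A) else 0 := by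
  change (∑ j ∈ Finset.range (s + 1),
      monomial j (decompose 𝒜 ((r : A[X]).coeff j) (s - j + d * j) : A)).coeff n = _
  rw [finsetSum_coeff]
  simp [coeff_monomial]

theorem reesTotalProj_mem (hI : IsGeneratedInDegree 𝒜 I d) (s : ℕ) (r : reesAlgebra I) :
    reesTotalProj hI s r ∈ reesGrading 𝒜 I d s := by
  rw [mem_reesGrading_iff]
  intro j
  rw [coeff_reesTotalProj]
  refine ⟨fun h => ?_, fun h => if_neg (by omega)⟩
  rw [if_pos h]
  exact SetLike.coe_mem _

theorem reesTotalProj_of_mem (hI : IsGeneratedInDegree 𝒜 I d) (s : ℕ) (r : reesAlgebra I)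
    (hr : r ∈ reesGrading 𝒜 I d s) : reesTotalProj hI s r = r := by
  rw [mem_reesGrading_iff] at hr
  ext n
  rw [coeff_reesTotalProj]
  split_ifs with h
  · exact decompose_of_mem_same 𝒜 ((hr n).1 h)
  · exact ((hr n).2 (by omega)).symm

theorem reesTotalProj_mul (hI : IsGeneratedInDegree 𝒜 I d) (s : ℕ) (a : reesAlgebra I)
    (ha : a ∈ reesGrading 𝒜 I d 1) (r : reesAlgebra I) :
    reesTotalProj hI (s + 1) (a * r) = a * reesTotalProj hI s r := by
  rw [mem_reesGrading_iff] at ha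
  have ha₀ : (a : A[X]).coeff 0 ∈ 𝒜 1 := by simpa using (ha 0).1 (by omega)
  have ha₁ : (a : A[X]).coeff 1 ∈ 𝒜 d := by simpa using (ha 1).1 (by omega)
  have ha' : (a : A[X]) = C ((a : A[X]).coeff 0) + C ((a : A[X]).coeff 1) * X := by
    ext n
    rcases n with _ | _ | n
    · simp
    · simp
    · simpa using (ha (n + 2)).2 (by omega)
  have hmul : ∀ x : A[X], (a * x).coeff 0 = (a : A[X]).coeff 0 * x.coeff 0 ∧
      ∀ n, (a * x).coeff (n + 1) =
        (a : A[X]).coeff 0 * x.coeff (n + 1) + (a : A[X]).coeff 1 * x.coeff n := by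
    intro x
    rw [ha']
    refine ⟨by simp, fun n => ?_⟩
    rw [add_mul, mul_assoc, coeff_add, coeff_C_mul, coeff_C_mul, coeff_X_mul]
    simp
  ext n
  rw [coeff_reesTotalProj, MulMemClass.coe_mul, MulMemClass.coe_mul]
  rcases n with _ | n
  · rw [(hmul _).1, (hmul _).1, coeff_reesTotalProj, if_pos (by omega), if_pos (by omega)]
    have := coe_decompose_mul_add_of_left_mem 𝒜 (b := (r : A[X]).coeff 0) (j := s) ha₀
    rw [show s + 1 - 0 + d * 0 = 1 + s by simp [add_comm], show s - 0 + d * 0 = s by simp]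
    exact this
  · rw [(hmul _).2, (hmul _).2, coeff_reesTotalProj, coeff_reesTotalProj]
    rcases Nat.lt_or_ge s n with hn | hn
    · rw [if_neg (by omega), if_neg (by omega), if_neg (by omega)]
      simp
    rw [if_pos (by omega), if_pos hn, decompose_add, DirectSum.add_apply, Submodule.coe_add]
    congr 1
    · split_ifs with hn'
      · rw [show s + 1 - (n + 1) + d * (n + 1) = 1 + (s - (n + 1) + d * (n + 1)) by
          generalize d * (n + 1) = q; omega, coe_decompose_mul_add_of_left_mem 𝒜 ha₀]
      -- Top coefficient: the left side has an extra term, a₀ times the component of degree d(n+1) -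
      -- 1 of an element of I^(n+1). It vanishes because that ideal is generated in degree d(n+1).
      · obtain rfl : n = s := by omega
        rw [mul_zero, show n + 1 - (n + 1) = 0 by omega, zero_add]
        have hr := (mem_reesAlgebra_iff I _).1 r.2 (n + 1)
        rcases h : d * (n + 1) with _ | k
        · exact coe_decompose_mul_of_left_mem_of_not_le 𝒜 ha₀ (by omega)
        · rw [add_comm, coe_decompose_mul_add_of_left_mem 𝒜 ha₀,
            (hI.pow (n + 1)).decompose_eq_zero hr (by omega), mul_zero]
    · rw [show s + 1 - (n + 1) + d * (n + 1) = d + (s - n + d * n) by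
        rw [mul_add_one]; generalize d * n = q; omega, coe_decompose_mul_add_of_left_mem 𝒜 ha₁]

/-- The structure of a bigraded retract on the Rees ring of an ideal generated in degree `d`. -/
noncomputable def reesRetract (hI : IsGeneratedInDegree 𝒜 I d) :
    BigradedRetract (R := reesAlgebra I) (fun s => (𝒜 s).toAddSubgroup)
      (fun s => (reesGrading 𝒜 I d s).toAddSubgroup) where
  π := (aeval (0 : A)).comp (reesAlgebra I).val
  yp := reesProj I
  tp := reesTotalProj hI
  π_mem s r hr := by
    have := ((mem_reesGrading_iff 𝒜 I d s r).1 hr 0).1 (by omega)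
    change aeval (0 : A) (r : A[X]) ∈ 𝒜 s
    rw [← coeff_zero_eq_aeval_zero]
    simpa using this
  ι_mem s a ha := (mem_reesGrading_iff 𝒜 I d s _).2 fun j => by
    change (j ≤ s → (C a).coeff j ∈ _) ∧ (s < j → (C a).coeff j = 0)
    rw [coeff_C]
    split_ifs with h
    · subst h
      exact ⟨fun _ => by simpa using ha, fun h => by omega⟩
    · exact ⟨fun _ => zero_mem _, fun _ => rfl⟩
  mul_mem s a ha r hr := by
    rw [← reesTotalProj_of_mem hI s r hr, ← reesTotalProj_mul hI s a ha]
    exact reesTotalProj_mem hI _ _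
  tp_mem := reesTotalProj_mem hI
  tp_of_mem := reesTotalProj_of_mem hI
  tp_mul := reesTotalProj_mul hI
  yp_mem s j r hr := by
    rcases lt_or_ge j 0 with hj | hj
    · rw [reesProj_of_neg hj]
      exact zero_mem _
    lift j to ℕ using hj
    have hr' := (mem_reesGrading_iff 𝒜 I d s r).1 hr
    refine (mem_reesGrading_iff 𝒜 I d s _).2 fun n => ?_
    rw [coe_reesProj_natCast, coeff_monomial]
    split_ifs with h
    · subst h
      exact hr' j
    · exact ⟨fun _ => zero_mem _, fun _ => rfl⟩
  yp_yp j r := by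
    rcases lt_or_ge j 0 with hj | hj
    · rw [reesProj_of_neg hj, reesProj_of_neg hj]
    lift j to ℕ using hj
    ext1
    rw [coe_reesProj_natCast, coe_reesProj_natCast, coeff_monomial_same]
  yp_mul := reesProj_mul
  yp_neg j hj r := reesProj_of_neg hj r
  yp_zero r := by
    ext1
    change (reesProj I (0 : ℕ) r : A[X]) = C (aeval (0 : A) (r : A[X]))
    rw [coe_reesProj_natCast, ← coeff_zero_eq_aeval_zero, monomial_zero_left]
  yp_add r hr := by
    have hr' := (mem_reesGrading_iff 𝒜 I d 1 r).1 hr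
    ext n
    change ((reesProj I (0 : ℕ) r : A[X]) + (reesProj I (1 : ℕ) r : A[X])).coeff n = _
    rw [coe_reesProj_natCast, coe_reesProj_natCast, coeff_add, coeff_monomial, coeff_monomial]
    rcases n with _ | _ | n
    · simp
    · simp
    · simpa using ((hr' (n + 2)).2 (by omega)).symm
  yp_eq_zero r hr j h0 h1 := by
    rcases lt_or_ge j 0 with hj | hj
    · exact reesProj_of_neg hj r
    lift j to ℕ using hj
    ext1
    rw [coe_reesProj_natCast, ((mem_reesGrading_iff 𝒜 I d 1 r).1 hr j).2 (by omega)]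
    simp

end Rees

/-! ### The main theorem -/

section Koszul

open DirectSum

variable {K A : Type*} [Field K] [CommRing A] [Algebra K A] {𝒜 : ℕ → Submodule K A}

theorem LinearResolution.isCpx {M : Type*} [AddCommGroup M] [Module K M] [Module A M]
    {ℳ : ℕ → Submodule K M} {a : ℕ} (F : LinearResolution 𝒜 ℳ a) :
    IsCpx fun i k l => F.d i (Pi.single k 1) l :=
  isCpx_of_linearMap fun i x => (F.exact_d i _).2 ⟨x, rfl⟩

theorem LinearResolution.exists_bd_succ {M : Type*} [AddCommGroup M] [Module K M] [Module A M]
    {ℳ : ℕ → Submodule K M} {a : ℕ} (F : LinearResolution 𝒜 ℳ a) (n : ℕ)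
    (x : Fin (F.rank (n + 1)) → A) (hx : bd (fun i k l => F.d i (Pi.single k 1) l) n x = 0) :
    ∃ z, bd (fun i k l => F.d i (Pi.single k 1) l) (n + 1) z = x := by
  rw [bd_of_linearMap] at hx
  obtain ⟨z, hz⟩ := (F.exact_d n x).1 hx
  exact ⟨z, by rw [bd_of_linearMap, hz]⟩

theorem LinearResolution.exists_bd_zero
    (F : LinearResolution 𝒜 (residueGrading 𝒜) 0) (x : Fin (F.rank 0) → A)
    (hx : ∀ k, x k ∈ gradedMaximalIdeal 𝒜) :
    ∃ z, bd (fun i k l => F.d i (Pi.single k 1) l) 0 z = x := by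
  have h0 : F.ε x = 0 := by
    rw [LinearMap.pi_apply_eq_sum_univ F.ε x]
    refine Finset.sum_eq_zero fun k _ => ?_
    obtain ⟨y, hy⟩ := Ideal.Quotient.mk_surjective (F.ε fun j => if k = j then 1 else 0)
    rw [← hy]
    change Ideal.Quotient.mk _ (x k * y) = 0
    exact Ideal.Quotient.eq_zero_iff_mem.2 (Ideal.mul_mem_right _ _ (hx k))
  obtain ⟨z, hz⟩ := (F.exact_ε x).1 h0
  exact ⟨z, by rw [bd_of_linearMap, hz]⟩

theorem IsStandardGraded.isNoetherianRing [GradedAlgebra 𝒜] (hA : IsStandardGraded 𝒜) :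
    IsNoetherianRing A := by
  obtain ⟨s, hs⟩ := hA.fg_degree_one
  have : Algebra.FiniteType K A := ⟨s, by
    rw [← Algebra.adjoin_span, hs, hA.adjoin_degree_one]⟩
  exact Algebra.FiniteType.isNoetherianRing K A

/-- The test in homological degree 0 gives 𝒜 (s + 1) ⊆ 𝒜 1 * 𝒜 s. -/
theorem fg_of_exactIn (h𝒜₀ : 𝒜 0 = 1) (hfg : (𝒜 1).FG) {f : ℕ → ℕ}
    {E : ∀ i, Fin (f (i + 1)) → Fin (f i) → A} (hE₁ : ∀ i k l, E i k l ∈ 𝒜 1) (l₀ : Fin (f 0))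
    (hexA : ∀ s i, ExactIn E (𝒜 s).toAddSubgroup (𝒜 (s + 1)).toAddSubgroup i) (s : ℕ) :
    (𝒜 s).FG := by
  induction s with
  | zero =>
    rw [h𝒜₀, Submodule.one_eq_span]
    exact Submodule.fg_span_singleton 1
  | succ s ih =>
    refine (hfg.mul ih).of_le fun x hx => ?_
    obtain ⟨w, hw, hwx⟩ := hexA s 0 (Pi.single l₀ x) (fun k => by
      rcases eq_or_ne k l₀ with rfl | hk
      · rwa [Pi.single_eq_same]
      · rw [Pi.single_eq_of_ne hk]; exact zero_mem _) trivial
    have := congrFun hwx l₀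
    rw [Pi.single_eq_same, bd_apply] at this
    rw [← this]
    exact sum_mem fun k _ => Submodule.mul_mem_mul (hE₁ _ _ _) (hw k)

variable [GradedAlgebra 𝒜]

theorem decompose_zero_of_mem_gradedMaximalIdeal {x : A} (hx : x ∈ gradedMaximalIdeal 𝒜) :
    (decompose 𝒜 x 0 : A) = 0 := by
  have h : gradedMaximalIdeal 𝒜 ≤ RingHom.ker (GradedRing.projZeroRingHom 𝒜) := by
    refine Ideal.span_le.2 ?_
    rintro y ⟨k, hk, hy⟩
    exact decompose_of_mem_ne 𝒜 hy hk.ne'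
  exact h hx

theorem one_notMem_gradedMaximalIdeal [Nontrivial A] : (1 : A) ∉ gradedMaximalIdeal 𝒜 := by
  intro h
  have := decompose_zero_of_mem_gradedMaximalIdeal h
  rw [decompose_of_mem_same 𝒜 (SetLike.one_mem_graded 𝒜)] at this
  exact one_ne_zero this

theorem isLinearSyzygy_gradedMaximalIdeal {f : ℕ → ℕ}
    {E : ∀ i, Fin (f (i + 1)) → Fin (f i) → A}
    (hexA : ∀ s i, ExactIn E (𝒜 s).toAddSubgroup (𝒜 (s + 1)).toAddSubgroup i) :
    IsLinearSyzygy 𝒜 E ⟨1, Submodule.comap (LinearMap.proj 0) (gradedMaximalIdeal 𝒜)⟩ := by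
  have hmem : ∀ s, 0 < s → ∀ x ∈ 𝒜 s, x ∈ gradedMaximalIdeal 𝒜 :=
    fun s hs x hx => Ideal.subset_span ⟨s, hs, hx⟩
  refine ⟨fun v hv s => ?_, fun v hv hv₀ => ?_, fun s i c hc hcyc => ?_⟩
  · change (decompose 𝒜 (v 0) s : A) ∈ gradedMaximalIdeal 𝒜
    rcases Nat.eq_zero_or_pos s with rfl | hs
    · rw [decompose_zero_of_mem_gradedMaximalIdeal (show v 0 ∈ _ from hv)]
      exact zero_mem _
    · exact hmem s hs _ (SetLike.coe_mem _)
  · ext k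
    rw [Subsingleton.elim k 0, ← decompose_of_mem_same 𝒜 (hv₀ 0)]
    exact decompose_zero_of_mem_gradedMaximalIdeal hv
  · obtain ⟨w, hw, hwc⟩ := ExactIn.pi (m := 1) (fun _ => hexA (s + 1) i) c (fun k => (hc k).1) hcyc
    exact ⟨w, fun k => ⟨hw k, hmem (s + 1) s.succ_pos _ (hw k 0 trivial)⟩, hwc⟩

/-- An ideal generated in degree `e` on which the test complex is exact in degrees above `e` has an
`e`-linear resolution. -/
theorem hasLinearResolution_ideal (h𝒜₀ : 𝒜 0 = 1) (hfg : (𝒜 1).FG) {f : ℕ → ℕ}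
    {E : ∀ i, Fin (f (i + 1)) → Fin (f i) → A}
    (hE₁ : ∀ i k l, E i k l ∈ 𝒜 1) (hE : IsCpx E) (l₀ : Fin (f 0))
    (hexA : ∀ s i, ExactIn E (𝒜 s).toAddSubgroup (𝒜 (s + 1)).toAddSubgroup i)
    {J : Ideal A} {e : ℕ} (hJ : IsGeneratedInDegree 𝒜 J e)
    (hex : ∀ s i, ExactIn E (idealGrading 𝒜 J (e + s)).toAddSubgroup
      (idealGrading 𝒜 J (e + s + 1)).toAddSubgroup i) :
    HasLinearResolution 𝒜 (idealGrading 𝒜 J) e := by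
  have hV : (idealGrading 𝒜 J e).FG := by
    refine Submodule.fg_of_fg_map_injective (J.subtype.restrictScalars K) Subtype.val_injective ?_
    exact (fg_of_exactIn h𝒜₀ hfg hE₁ l₀ hexA e).of_le (Submodule.map_comap_le _ _)
  obtain ⟨m, v, hli, hspan⟩ := exists_fin_basis hV
  have hv : ∀ k, (v k : A) ∈ 𝒜 e := fun k => by
    have : v k ∈ Submodule.span K (Set.range v) := Submodule.subset_span ⟨k, rfl⟩
    rwa [hspan] at this
  obtain ⟨hz, -⟩ := isLinearSyzygy_ker h𝒜₀ hE₁ hE l₀ hexA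
    (ℳ := fun s => (idealGrading 𝒜 J (e + s)).toAddSubgroup) hex hli
    (fun x hx => by rw [hspan]; exact hx)
    (fun s b hb k => by
      change b * (v k : A) ∈ 𝒜 (e + s)
      rw [add_comm]
      exact SetLike.mul_mem_graded hb (hv k))
    (fun r hr s => by
      ext1
      have h3 := congrArg (fun x : J => GradedRing.proj 𝒜 (s + e) (x : A)) hr
      simp only [Fintype.linearCombination_apply, AddSubmonoidClass.coe_finsetSum,
        Submodule.coe_smul, smul_eq_mul, map_sum, ZeroMemClass.coe_zero, map_zero] at h3 ⊢
      rw [← h3]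
      exact Finset.sum_congr rfl fun k _ => (coe_decompose_mul_add_of_right_mem 𝒜 (hv k)).symm)
  refine IsLinearSyzygy.hasLinearResolution h𝒜₀ hfg hE₁ hE l₀ hexA
    (ε := Fintype.linearCombination A v) ?_ (fun k => ?_) hz
  · rw [← LinearMap.range_eq_top, Fintype.range_linearCombination]
    obtain ⟨t, ht, rfl⟩ := hJ
    have : Submodule.map (Ideal.span t).subtype (Submodule.span A (Set.range v)) =
        Submodule.map (Ideal.span t).subtype ⊤ := by
      refine le_antisymm (Submodule.map_mono le_top) ?_
      rw [Submodule.map_top, Submodule.range_subtype]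
      refine Ideal.span_le.2 fun x hx => ⟨⟨x, Ideal.subset_span hx⟩, ?_, rfl⟩
      have hxV : (⟨x, Ideal.subset_span hx⟩ : Ideal.span t) ∈ idealGrading 𝒜 (Ideal.span t) e :=
        ht hx
      rw [← hspan] at hxV
      exact Submodule.span_le_restrictScalars K A _ hxV
    exact Submodule.map_injective_of_injective Subtype.val_injective this
  · rw [Fintype.linearCombination_apply_single, one_smul]
    exact hv k

-- Multiplication by tʲ identifies Iʲ with the strand of y-degree j, degree dj + s becoming total
-- degree j + s; taking the j-th coefficient is the inverse.
open Polynomial in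
theorem exactIn_idealGrading_pow [IsNoetherianRing A] {I : Ideal A} {d : ℕ}
    (hI : IsGeneratedInDegree 𝒜 I d) {f : ℕ → ℕ}
    {D : ∀ i, Fin (f (i + 1)) → Fin (f i) → reesAlgebra I}
    (hD : IsCpx D) (hD₁ : ∀ i k l, D i k l ∈ reesGrading 𝒜 I d 1) (l₀ : Fin (f 0))
    (hexR : ∀ s i, ExactIn D (reesGrading 𝒜 I d s).toAddSubgroup
      (reesGrading 𝒜 I d (s + 1)).toAddSubgroup i)
    (hexA : ∀ s i, ExactIn (fun i k l => (reesRetract hI).π (D i k l)) (𝒜 s).toAddSubgroup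
      (𝒜 (s + 1)).toAddSubgroup i) (j s i : ℕ) :
    ExactIn (fun i k l => (reesRetract hI).π (D i k l))
      (idealGrading 𝒜 (I ^ j) (d * j + s)).toAddSubgroup
      (idealGrading 𝒜 (I ^ j) (d * j + s + 1)).toAddSubgroup i := by
  intro c hc hcyc
  let μ : ↥(I ^ j) →ₗ[A] reesAlgebra I := LinearMap.codRestrict
    (Subalgebra.toSubmodule (reesAlgebra I)) (monomial j ∘ₗ (I ^ j).subtype)
    fun x => reesAlgebra.monomial_mem.2 x.2
  let ν : reesAlgebra I →ₗ[A] ↥(I ^ j) := LinearMap.codRestrict _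
    (lcoeff A j ∘ₗ (reesAlgebra I).val.toLinearMap) fun x => (mem_reesAlgebra_iff I _).1 x.2 j
  have hμ : ∀ x, ((μ x : reesAlgebra I) : A[X]) = monomial j (x : A) := fun x => rfl
  have hν : ∀ r, (ν r : A) = (r : A[X]).coeff j := fun r => rfl
  have hνμ : ∀ x, ν (μ x) = x := fun x => by
    ext1
    rw [hν, hμ, coeff_monomial_same]
  obtain ⟨w, hw, hwc⟩ := (reesRetract hI).exactIn_yDeg hD hD₁ l₀ hexR hexA (j + 1) j
    (by push_cast; omega) (s + j) (by push_cast; omega) i (fun k => μ (c k)) (fun k => by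
      refine ⟨(mem_reesGrading_iff 𝒜 I d _ _).2 fun n => ?_, ?_⟩
      · rw [hμ, coeff_monomial]
        split_ifs with h
        · subst h
          refine ⟨fun _ => ?_, fun h => by omega⟩
          rw [show s + j + 1 - j + d * j = d * j + s + 1 by generalize d * j = q; omega]
          exact hc k
        · exact ⟨fun _ => zero_mem _, fun _ => rfl⟩
      · change reesProj I j (μ (c k)) = μ (c k)
        ext1
        rw [coe_reesProj_natCast, hμ, coeff_monomial_same])
    (hcyc.map (q := μ.toAddMonoidHom) fun i w => bd_map _ μ i w)
  refine ⟨fun k => ν (w k), fun k => ?_, ?_⟩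
  · have := ((mem_reesGrading_iff 𝒜 I d _ _).1 (hw k).1 j).1 (by omega)
    rw [show s + j - j + d * j = d * j + s by generalize d * j = q; omega] at this
    exact this
  · rw [← bd_map _ ν i w, hwc]
    exact funext fun l => hνμ (c l)

end Koszul

theorem mainTheorem8 {K A : Type*} [Field K] [CommRing A] [Algebra K A]
    (𝒜 : ℕ → Submodule K A) [GradedAlgebra 𝒜] (hA : IsStandardGraded 𝒜)
    (I : Ideal A) (d : ℕ) (hI : IsGeneratedInDegree 𝒜 I d)
    (hR : IsKoszul (reesGrading 𝒜 I d)) :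
    IsKoszul 𝒜 ∧ ∀ j : ℕ, HasLinearResolution 𝒜 (idealGrading 𝒜 (I ^ j)) (d * j) := by
  obtain ⟨F⟩ := hR
  have := hA.isNoetherianRing
  have := hA.nontrivial
  let S := reesRetract hI
  have hD := F.isCpx
  set D := fun i k l => F.d i (Pi.single k 1) l with hDdef
  have hD₁ : ∀ i k l, D i k l ∈ reesGrading 𝒜 I d 1 := F.d_mem
  have hπ : gradedMaximalIdeal (reesGrading 𝒜 I d) ≤ (gradedMaximalIdeal 𝒜).comap S.π := by
    refine Ideal.span_le.2 ?_
    rintro r ⟨k, hk, hr⟩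
    exact Ideal.subset_span ⟨k, hk, S.π_mem k r hr⟩
  have hι : (gradedMaximalIdeal 𝒜).map (algebraMap A (reesAlgebra I)) ≤
      gradedMaximalIdeal (reesGrading 𝒜 I d) := by
    refine Ideal.map_le_iff_le_comap.2 (Ideal.span_le.2 ?_)
    rintro a ⟨k, hk, ha⟩
    exact Ideal.subset_span ⟨k, hk, S.ι_mem k a ha⟩
  -- Rank 0 would make the residue module of R vanish, and π would then put 1 into 𝔪.
  have l₀ : Fin (F.rank 0) := by
    refine Classical.choice (not_isEmpty_iff.1 fun h => ?_)
    obtain ⟨x, hx⟩ := F.surjective_ε (Ideal.Quotient.mk _ 1)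
    rw [Subsingleton.elim x 0, map_zero] at hx
    have h1 := hπ (Ideal.Quotient.eq_zero_iff_mem.1 hx.symm)
    rw [Ideal.mem_comap, map_one] at h1
    exact one_notMem_gradedMaximalIdeal h1
  have hexR : ∀ s i, ExactIn D (reesGrading 𝒜 I d s).toAddSubgroup
      (reesGrading 𝒜 I d (s + 1)).toAddSubgroup i := by
    intro s i c hc hcyc
    have hz : ∃ z, bd D i z = c := by
      cases i with
      | zero => exact F.exists_bd_zero c fun k => Ideal.subset_span ⟨s + 1, s.succ_pos, hc k⟩
      | succ i => exact F.exists_bd_succ i c hcyc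
    obtain ⟨z, rfl⟩ := hz
    -- The entries of `D` have degree 1, so the degree-s part of the preimage still bounds the
    -- cycle, which is homogeneous of degree s + 1.
    refine ⟨fun k => S.tp s (z k), fun k => S.tp_mem _ _, ?_⟩
    ext1 l
    rw [← S.tp_of_mem _ _ (hc l), bd_apply, bd_apply, map_sum]
    exact Finset.sum_congr rfl fun k _ => (S.tp_mul s _ (hD₁ i k l) (z k)).symm
  have hexA : ∀ s i, ExactIn (fun i k l => S.π (D i k l)) (𝒜 s).toAddSubgroup
      (𝒜 (s + 1)).toAddSubgroup i := by
    intro s i c hc hcyc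
    obtain ⟨z, rfl⟩ := exists_boundary_of_retract_of_isNoetherianRing S.π hD
      (gradedMaximalIdeal 𝒜) F.exists_bd_succ (fun x hx => F.exists_bd_zero x fun k => hι (hx k))
      i c (fun k => Ideal.subset_span ⟨s + 1, s.succ_pos, hc k⟩) hcyc
    refine ⟨fun k => DirectSum.decompose 𝒜 (z k) s, fun k => SetLike.coe_mem _, ?_⟩
    ext1 l
    have h1 := DirectSum.decompose_of_mem_same 𝒜 (hc l)
    rw [← h1, bd_apply, bd_apply]
    change _ = GradedRing.proj 𝒜 (s + 1) _
    rw [map_sum]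
    refine Finset.sum_congr rfl fun k _ => ?_
    rw [add_comm s 1]
    exact (DirectSum.coe_decompose_mul_add_of_left_mem 𝒜 (S.π_mem 1 _ (hD₁ i k l))).symm
  have hE₁ : ∀ i k l, S.π (D i k l) ∈ 𝒜 1 := fun i k l => S.π_mem 1 _ (hD₁ i k l)
  have hE : IsCpx fun i k l => S.π (D i k l) := hD.map (S.π : reesAlgebra I →+* A)
  refine ⟨?_, fun j => hasLinearResolution_ideal hA.degree_zero hA.fg_degree_one hE₁ hE l₀ hexA
    (hI.pow j) fun s i => exactIn_idealGrading_pow hI hD hD₁ l₀ hexR hexA j s i⟩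
  have hker : LinearMap.ker ((gradedMaximalIdeal 𝒜).mkQ ∘ₗ
      (LinearMap.proj 0 : (Fin 1 → A) →ₗ[A] A)) =
      Submodule.comap (LinearMap.proj 0) (gradedMaximalIdeal 𝒜) := by
    rw [LinearMap.ker_comp, Submodule.ker_mkQ]
  refine IsLinearSyzygy.hasLinearResolution hA.degree_zero hA.fg_degree_one hE₁ hE l₀ hexA
    (ε := (gradedMaximalIdeal 𝒜).mkQ ∘ₗ (LinearMap.proj 0 : (Fin 1 → A) →ₗ[A] A)) ?_ (fun k => ?_)
    (by rw [hker]; exact isLinearSyzygy_gradedMaximalIdeal hexA)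
  · exact (Submodule.mkQ_surjective _).comp fun a => ⟨fun _ => a, rfl⟩
  · rw [Subsingleton.elim k 0]
    exact ⟨1, SetLike.one_mem_graded 𝒜, by simp⟩
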